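/- There are absolute constants $C>0$ and $\mathcal C>0$ with the following property. Let $1\le s\le n$ and let $f:\mathbb R^n\to\mathbb R$ be twice continuously differentiable with $L$-Lipschitz gradient and $M$-Lipschitz Hessian (in operator norm), i.e. $\|\nabla f(x)-\nabla f(y)\|\le L\|x-y\|$ and $\|\nabla^2 f(x)-\nabla^2 f(y)\|\le M\|x-y\|$ for all $x,y$. Let $\delta\ge 0$ and $\Delta>0$, and let $(x_k)_{k\ge 0}$ be generated by the Random Subspace Homogenized Trust Region method (RSHTR): starting from $x_0$ in "global mode" with parameter $\delta_0=\delta$, at iteration $k$ 1. draw a random matrix $P_k\in\mathbb R^{s\times n}$ with independent $\mathcal N(0,1/s)$ entries, independent of everything before iteration $k$; 2. with $\tilde g_k=P_k\nabla f(x_k)$ and $\tilde H_k=P_k\nabla^2 f(x_k)P_k^\top$, take a minimizer $[\tilde v_k;t_k]\in\mathbb R^{s+1}$ of $$\begin{bmatrix}\tilde v\\ t\end{bmatrix}^{\top}\begin{bmatrix}\tilde H_k&\tilde g_k\\ \tilde g_k^\top&-\delta_k\end{bmatrix}\begin{bmatrix}\tilde v\\ t\end{bmatrix}\quad\text{over }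 \|[\tilde v;t]\|\le 1;$$ 3. put $d_k=P_k^\top\tilde v_k/t_k$ if $t_k\ne 0$ and $d_k=P_k^\top\tilde v_k$ otherwise; 4. if the method is in global mode and $\|d_k\|>\Delta$, set $x_{k+1}=x_k+(\Delta/\|d_k\|)d_k$, and stay in global mode with $\delta_{k+1}=\delta$; otherwise set $x_{k+1}=x_k+d_k$, leave global mode for good and set $\delta_j=0$ for all $j>k$. Suppose that $x_k$ converges almost surely to a point $\bar x$ with $\nabla f(\bar x)=0$ and $\bar H:=\nabla^2 f(\bar x)\succ 0$. Write $\|x\|_{\bar H}=\sqrt{x^\top\bar H x}$ and $\kappa(\bar H)=\lambda_{\max}(\bar H)/\lambda_{\min}(\bar H)$. Then there is $k_0$ such that for all $k\ge k_0$ $$\Pr\left[\|x_{k+1}-\bar x\|_{\bar H}\le\sqrt{1-\frac{1}{4\,\kappa(\bar H)\,(\sqrt{n/s}+\mathcal C)^2}}\;\|x_k-\bar x\|_{\bar H}\right]\ \ge\ 1-2\exp\left(-\tfrac{C}{4}s\right)-8\exp(-s).$$ -/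

import Mathlib

open MeasureTheory ProbabilityTheory Filter Topology
open scoped Matrix Gradient

noncomputable section

/-- The Hessian of `f` at `x`, as a linear operator on Euclidean space: the derivative of `∇ f`.
Its norm is the operator (spectral) norm. -/
def hessOp {n : ℕ} (f : EuclideanSpace ℝ (Fin n) → ℝ) (x : EuclideanSpace ℝ (Fin n)) :
    EuclideanSpace ℝ (Fin n) →L[ℝ] EuclideanSpace ℝ (Fin n) :=
  fderiv ℝ (∇ f) x

/-- The Hessian of `f` at `x`, as a matrix in the standard basis. -/
def hessMat {n : ℕ} (f : EuclideanSpace ℝ (Fin n) → ℝ) (x : EuclideanSpace ℝ (Fin n)) :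
    Matrix (Fin n) (Fin n) ℝ :=
  Matrix.of fun i j => hessOp f x (EuclideanSpace.single j 1) i

/-- The largest eigenvalue of a real symmetric matrix. -/
def lambdaMax {n : ℕ} (A : Matrix (Fin n) (Fin n) ℝ) : ℝ := sSup (spectrum ℝ A)

/-- The smallest eigenvalue of a real symmetric matrix. -/
def lambdaMin {n : ℕ} (A : Matrix (Fin n) (Fin n) ℝ) : ℝ := sInf (spectrum ℝ A)

/-- The condition number `κ(A) = λ_max(A) / λ_min(A)` of a symmetric positive definite matrix. -/
def condNumber {n : ℕ} (A : Matrix (Fin n) (Fin n) ℝ) : ℝ := lambdaMax A / lambdaMin A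

/-- The norm `‖x‖_A = √(xᵀ A x)` given by a symmetric positive definite matrix `A`. -/
def matNorm {n : ℕ} (A : Matrix (Fin n) (Fin n) ℝ) (x : EuclideanSpace ℝ (Fin n)) : ℝ :=
  √(x.ofLp ⬝ᵥ A *ᵥ x.ofLp)

/-- Lipschitz gradient (constant `L`) and Lipschitz Hessian (constant `M`) for a `C²` function. -/
structure HasLipschitzGradHess {n : ℕ} (f : EuclideanSpace ℝ (Fin n) → ℝ) (L M : ℝ) : Prop where
  contDiff : ContDiff ℝ 2 f
  grad_lipschitz : ∀ x y, ‖∇ f x - ∇ f y‖ ≤ L * ‖x - y‖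
  hess_lipschitz : ∀ x y, ‖hessOp f x - hessOp f y‖ ≤ M * ‖x - y‖

/-- The list of the entries of an `s × n` matrix. -/
def matEntries {s n : ℕ} (A : Matrix (Fin s) (Fin n) ℝ) : Fin s × Fin n → ℝ :=
  fun p => A p.1 p.2

/-- `P` is a random `s × n` matrix with independent `N(0, 1/s)` entries. -/
structure IsGaussianMatrix {Ω : Type*} [MeasurableSpace Ω] (μ : Measure Ω) {s n : ℕ}
    (P : Ω → Matrix (Fin s) (Fin n) ℝ) : Prop where
  indep : iIndepFun (fun (p : Fin s × Fin n) (ω : Ω) => P ω p.1 p.2) μ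
  law : ∀ i j, HasLaw (fun ω => P ω i j) (gaussianReal 0 ((s : NNReal)⁻¹)) μ

/-- The symmetric matrix `[H, g; gᵀ, -δ]` of the homogenized quadratic model. -/
def homMat {s : ℕ} (H : Matrix (Fin s) (Fin s) ℝ) (g : Fin s → ℝ) (δ : ℝ) :
    Matrix (Fin s ⊕ Unit) (Fin s ⊕ Unit) ℝ :=
  Matrix.fromBlocks H (Matrix.of fun i _ => g i) (Matrix.of fun _ j => g j)
    (Matrix.of fun _ _ => -δ)

/-- The vector `[v; t]`. -/
def homVec {s : ℕ} (v : Fin s → ℝ) (t : ℝ) : Fin s ⊕ Unit → ℝ := Sum.elim v (fun _ => t)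

/-- `[v; t]` minimizes the quadratic form of `[H, g; gᵀ, -δ]` over the closed Euclidean unit ball
of `ℝ^(s+1)`. -/
def IsSubproblemSol {s : ℕ} (H : Matrix (Fin s) (Fin s) ℝ) (g : Fin s → ℝ) (δ : ℝ)
    (v : Fin s → ℝ) (t : ℝ) : Prop :=
  homVec v t ∈ {u : Fin s ⊕ Unit → ℝ | u ⬝ᵥ u ≤ 1} ∧
    IsMinOn (fun u : Fin s ⊕ Unit → ℝ => u ⬝ᵥ homMat H g δ *ᵥ u) {u | u ⬝ᵥ u ≤ 1} (homVec v t)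

/-- The direction: `Pᵀ v / t` if `t ≠ 0`, and `Pᵀ v` otherwise. -/
def rshtrDir {s n : ℕ} (P : Matrix (Fin s) (Fin n) ℝ) (v : Fin s → ℝ) (t : ℝ) :
    EuclideanSpace ℝ (Fin n) :=
  if t ≠ 0 then WithLp.toLp 2 (t⁻¹ • (Pᵀ *ᵥ v)) else WithLp.toLp 2 (Pᵀ *ᵥ v)

/-- The update of the iterate: in global mode a direction longer than `Δ` is cut to length `Δ`;
otherwise the full direction is taken. -/
def rshtrStep {n : ℕ} (Δ : ℝ) (globalMode : Bool) (x d : EuclideanSpace ℝ (Fin n)) :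
    EuclideanSpace ℝ (Fin n) :=
  if globalMode = true ∧ Δ < ‖d‖ then x + (Δ / ‖d‖) • d else x + d

/-- `x` is the sequence of iterates of a run of RSHTR on `f` with parameters `δ`, `Δ`, which is
continued with `δ` reset to `0` and with full steps once the stopping test `‖d_k‖ ≤ Δ` has
succeeded. `P k` are the random matrices, `(v k, t k)` the computed optimal solutions of the
subproblems, `gm k` tells whether iteration `k` is still in global mode, and `ℱ k` is the
information available before iteration `k`, from which the fresh matrix `P k` is independent. -/
structure IsRSHTRRun {n s : ℕ} (f : EuclideanSpace ℝ (Fin n) → ℝ) (δ Δ : ℝ)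
    {Ω : Type*} [mΩ : MeasurableSpace Ω] (μ : Measure Ω) (ℱ : Filtration ℕ mΩ)
    (P : ℕ → Ω → Matrix (Fin s) (Fin n) ℝ) (v : ℕ → Ω → Fin s → ℝ) (t : ℕ → Ω → ℝ)
    (gm : ℕ → Ω → Bool) (x : ℕ → Ω → EuclideanSpace ℝ (Fin n)) : Prop where
  gaussian : ∀ k, IsGaussianMatrix μ (P k)
  indep_past : ∀ k,
    Indep (MeasurableSpace.comap (fun ω => matEntries (P k ω)) inferInstance) (ℱ k) μ
  measurable_mat : ∀ k, Measurable[ℱ (k + 1)] (fun ω => matEntries (P k ω))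
  measurable_v : ∀ k, Measurable[ℱ (k + 1)] (v k)
  measurable_t : ∀ k, Measurable[ℱ (k + 1)] (t k)
  measurable_init : Measurable[ℱ 0] (x 0)
  subproblem : ∀ k ω, IsSubproblemSol (P k ω * hessMat f (x k ω) * (P k ω)ᵀ)
    (P k ω *ᵥ (∇ f (x k ω)).ofLp) (if gm k ω = true then δ else 0) (v k ω) (t k ω)
  mode_zero : ∀ ω, gm 0 ω = true
  mode_succ : ∀ k ω,
    gm (k + 1) ω = true ↔ gm k ω = true ∧ Δ < ‖rshtrDir (P k ω) (v k ω) (t k ω)‖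
  step : ∀ k ω,
    x (k + 1) ω = rshtrStep Δ (gm k ω) (x k ω) (rshtrDir (P k ω) (v k ω) (t k ω))

end

/-!
Steps in global mode have length `Δ`, so a convergent run takes only finitely many of them, and
`δ = 0` from then on. At a point with gradient `g` and positive semidefinite Hessian `H`, the
subproblem with `δ = 0` is an eigenvalue problem whose solution `d = Pᵀ w` is a regularized Newton
step in the random subspace: `(P H Pᵀ + θ) w = -P g` with `θ = -⟨g, d⟩ ≥ ⟨d, H d⟩`. To leading order
this step lowers the squared error `‖x - xbar‖²`, in the norm of the limiting Hessian, by at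
least `θ`, while `‖g‖²` is at least `λ_min` times that squared error. The Cauchy-Schwarz inequality
for the form `P H Pᵀ + θ` gives `‖P g‖⁴ ≤ θ (⟨Pᵀ P g, H Pᵀ P g⟩ + θ ‖P g‖²)`, so `θ` is at least
of order `‖g‖² / λ_max` once `‖P g‖` is not small and `‖Pᵀ P g‖` is not large.

For a fixed `g` these two properties of `P` hold with high probability by chi-squared tail bounds,
and `P k` is independent of `x k`, so they also hold for `g = ∇ f (x k)`. Near `xbar` the deviation
of `f` from its quadratic model is absorbed by the slack in the constant.
-/

section Gaussian

theorem mgf_sq_gaussianReal {v : NNReal} {c : ℝ} (hc : 2 * c * v < 1) :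
    mgf (fun x => x ^ 2) (gaussianReal 0 v) c = (√(1 - 2 * c * v))⁻¹ := by
  rcases eq_or_ne v 0 with rfl | hv
  · simp [mgf, gaussianReal_zero_var]
  have : (0 : ℝ) < v := by positivity
  have hdensity (x : ℝ) : gaussianPDFReal 0 v x * Real.exp (c * x ^ 2)
      = (√(2 * Real.pi * v))⁻¹ * Real.exp (-((1 - 2 * c * v) / (2 * v)) * x ^ 2) := by
    rw [gaussianPDFReal, mul_assoc, ← Real.exp_add]
    congr 2
    field_simp
    ring
  have : 1 - 2 * c * (v : ℝ) ≠ 0 := by linarith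
  simp only [mgf, integral_gaussianReal_eq_integral_smul hv, smul_eq_mul, hdensity]
  rw [integral_const_mul, integral_gaussian, ← Real.sqrt_inv, ← Real.sqrt_mul (by positivity),
    ← Real.sqrt_inv]
  congr 1
  field_simp

/-- The random vector `X` has independent coordinates, all of them with law `N(0, v)`. -/
structure IsIIDGaussian {Ω ι : Type*} [MeasurableSpace Ω] (μ : Measure Ω) (v : NNReal)
    (X : Ω → ι → ℝ) : Prop where
  indep : iIndepFun (fun i ω => X ω i) μ
  law : ∀ i, HasLaw (fun ω => X ω i) (gaussianReal 0 v) μ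

namespace IsIIDGaussian

variable {Ω ι κ κ' : Type*} [MeasurableSpace Ω] {μ : Measure Ω} {v : NNReal} {X : Ω → ι → ℝ}

theorem reindex (hX : IsIIDGaussian μ v X) {e : κ → ι} (he : e.Injective) :
    IsIIDGaussian μ v (fun ω j => X ω (e j)) :=
  ⟨hX.indep.precomp he, fun j => hX.law (e j)⟩

theorem aemeasurable [Countable ι] (hX : IsIIDGaussian μ v X) : AEMeasurable X μ :=
  aemeasurable_pi_lambda _ fun i => (hX.law i).aemeasurable

variable [Fintype ι]

theorem mgf_dotProduct_self (hX : IsIIDGaussian μ v X) {c : ℝ} (hc : 2 * c * v < 1) :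
    mgf (fun ω => X ω ⬝ᵥ X ω) μ c = (√(1 - 2 * c * v))⁻¹ ^ Fintype.card ι := by
  have hindep : iIndepFun (fun i ω => X ω i ^ 2) μ :=
    hX.indep.comp (fun _ x => x ^ 2) (by fun_prop)
  have hcoord (i : ι) : mgf (fun ω => X ω i ^ 2) μ c = (√(1 - 2 * c * v))⁻¹ := by
    rw [← mgf_sq_gaussianReal hc, ← (hX.law i).map_eq,
      mgf_map (hX.law i).aemeasurable (by fun_prop)]
    rfl
  have hsum : (fun ω => X ω ⬝ᵥ X ω) = ∑ i, fun ω => X ω i ^ 2 := by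
    ext ω
    simp [dotProduct, pow_two]
  rw [hsum, hindep.mgf_sum₀ fun i => (hX.law i).aemeasurable.pow_const 2]
  simp [hcoord]

theorem integrable_exp_mul_dotProduct_self (hX : IsIIDGaussian μ v X) {c : ℝ}
    (hc : 2 * c * v < 1) : Integrable (fun ω => Real.exp (c * (X ω ⬝ᵥ X ω))) μ := by
  by_contra h
  have hpos : 0 < (√(1 - 2 * c * v))⁻¹ ^ Fintype.card ι :=
    pow_pos (inv_pos.2 (Real.sqrt_pos.2 (by linarith))) _
  rw [← hX.mgf_dotProduct_self hc, mgf, integral_undef h] at hpos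
  exact hpos.false

theorem measure_le_dotProduct_self_le [IsProbabilityMeasure μ] (hX : IsIIDGaussian μ v X)
    (hv : v ≠ 0) (t : ℝ) :
    μ.real {ω | v * (3 / 2 * Fintype.card ι + 4 * t) ≤ X ω ⬝ᵥ X ω} ≤ Real.exp (-t) := by
  have : (0 : ℝ) < v := by positivity
  have hc : 2 * (1 / (4 * v)) * (v : ℝ) = 1 / 2 := by field_simp; norm_num
  have hbase : (√(1 - 1 / 2))⁻¹ ≤ Real.exp (3 / 8) := by
    rw [← Real.sqrt_inv, Real.sqrt_le_left (by positivity), ← Real.exp_nat_mul,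
      ← Real.log_le_iff_le_exp (by norm_num)]
    norm_num
    linarith [Real.log_two_lt_d9]
  calc μ.real {ω | v * (3 / 2 * Fintype.card ι + 4 * t) ≤ X ω ⬝ᵥ X ω}
      ≤ Real.exp (-(1 / (4 * v)) * (v * (3 / 2 * Fintype.card ι + 4 * t)))
          * mgf (fun ω => X ω ⬝ᵥ X ω) μ (1 / (4 * v)) :=
        measure_ge_le_exp_mul_mgf _ (by positivity)
          (hX.integrable_exp_mul_dotProduct_self (hc.trans_lt (by norm_num)))
    _ ≤ Real.exp (-(1 / (4 * v)) * (v * (3 / 2 * Fintype.card ι + 4 * t)))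
          * Real.exp (3 / 8) ^ Fintype.card ι := by
        rw [hX.mgf_dotProduct_self (hc.trans_lt (by norm_num)), hc]
        gcongr
    _ = Real.exp (-t) := by
        rw [← Real.exp_nat_mul, ← Real.exp_add]
        congr 1
        field_simp
        ring

theorem measure_dotProduct_self_le_le [IsProbabilityMeasure μ] (hX : IsIIDGaussian μ v X)
    (hv : v ≠ 0) :
    μ.real {ω | X ω ⬝ᵥ X ω ≤ v * (1 / 2 * Fintype.card ι)}
      ≤ Real.exp (-(1 / 20) * Fintype.card ι) := by
  have : (0 : ℝ) < v := by positivity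
  have hc : 2 * -(1 / (2 * v)) * (v : ℝ) = -1 := by field_simp
  have hbase : (√(1 - -1))⁻¹ ≤ Real.exp (-(3 / 10)) := by
    rw [← Real.sqrt_inv, Real.sqrt_le_left (by positivity), ← Real.exp_nat_mul,
      ← Real.log_le_iff_le_exp (by norm_num), Real.log_inv]
    norm_num
    linarith [Real.log_two_gt_d9]
  calc μ.real {ω | X ω ⬝ᵥ X ω ≤ v * (1 / 2 * Fintype.card ι)}
      ≤ Real.exp (- -(1 / (2 * v)) * (v * (1 / 2 * Fintype.card ι)))
          * mgf (fun ω => X ω ⬝ᵥ X ω) μ (-(1 / (2 * v))) :=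
        measure_le_le_exp_mul_mgf _ (by rw [neg_nonpos]; positivity)
          (hX.integrable_exp_mul_dotProduct_self (hc.trans_lt (by norm_num)))
    _ ≤ Real.exp (- -(1 / (2 * v)) * (v * (1 / 2 * Fintype.card ι)))
          * Real.exp (-(3 / 10)) ^ Fintype.card ι := by
        rw [hX.mgf_dotProduct_self (hc.trans_lt (by norm_num)), hc]
        gcongr
    _ = Real.exp (-(1 / 20) * Fintype.card ι) := by
        rw [← Real.exp_nat_mul, ← Real.exp_add]
        congr 1
        field_simp
        ring

theorem covariance_dotProduct [IsProbabilityMeasure μ] (hX : IsIIDGaussian μ v X) (a b : ι → ℝ) :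
    cov[fun ω => a ⬝ᵥ X ω, fun ω => b ⬝ᵥ X ω; μ] = v * (a ⬝ᵥ b) := by
  classical
  have hL (i : ι) : MemLp (fun ω => X ω i) 2 μ := (hX.law i).hasGaussianLaw.memLp_two
  have hcov (i j : ι) :
      cov[fun ω => X ω i, fun ω => X ω j; μ] = if i = j then (v : ℝ) else 0 := by
    split_ifs with hij
    · rw [hij, covariance_self (hX.law j).aemeasurable, (hX.law j).variance_eq,
        variance_id_gaussianReal]
    · exact (hX.indep.indepFun hij).covariance_eq_zero (hL i) (hL j)
  simp only [dotProduct]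
  rw [covariance_fun_sum_fun_sum (fun i => (hL i).const_mul _) (fun i => (hL i).const_mul _)]
  simp only [covariance_const_mul_left, covariance_const_mul_right, hcov, mul_ite, mul_zero,
    Finset.sum_ite_eq, Finset.mem_univ, if_true, Finset.mul_sum]
  exact Finset.sum_congr rfl fun i _ => by ring

theorem integral_dotProduct (hX : IsIIDGaussian μ v X) (a : ι → ℝ) :
    μ[fun ω => a ⬝ᵥ X ω] = 0 := by
  simp only [dotProduct]
  rw [integral_finsetSum _ fun i _ => ((hX.law i).hasGaussianLaw.integrable).const_mul _]
  refine Finset.sum_eq_zero fun i _ => ?_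
  rw [integral_const_mul, (hX.law i).integral_eq, integral_id_gaussianReal, mul_zero]

theorem hasGaussianLaw_mulVec [Finite κ] (hX : IsIIDGaussian μ v X) (A : Matrix κ ι ℝ) :
    HasGaussianLaw (fun ω => A *ᵥ X ω) μ :=
  have := Fintype.ofFinite κ
  (hX.indep.hasGaussianLaw fun i => (hX.law i).hasGaussianLaw).map_fun
    (LinearMap.toContinuousLinearMap A.mulVecLin)

theorem mulVec [IsProbabilityMeasure μ] [Finite κ] [DecidableEq κ] (hX : IsIIDGaussian μ v X)
    {A : Matrix κ ι ℝ} {w : NNReal} (hA : A * Aᵀ = (w : ℝ) • (1 : Matrix κ κ ℝ)) :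
    IsIIDGaussian μ (v * w) (fun ω => A *ᵥ X ω) := by
  have := Fintype.ofFinite κ
  have hcov (k l : κ) : cov[fun ω => (A *ᵥ X ω) k, fun ω => (A *ᵥ X ω) l; μ]
      = v * ((w : ℝ) • (1 : Matrix κ κ ℝ)) k l :=
    (hX.covariance_dotProduct _ _).trans (congrArg _ (congrFun₂ hA k l))
  have hG := hX.hasGaussianLaw_mulVec A
  refine ⟨hG.iIndepFun_of_covariance_eq_zero fun k l hkl => ?_, fun k => ?_⟩
  · simp [hcov, hkl]
  · have hGk : HasGaussianLaw (fun ω => (A *ᵥ X ω) k) μ := hG.eval k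
    refine ⟨hGk.aemeasurable, ?_⟩
    rw [hGk.map_eq_gaussianReal, ← covariance_self hGk.aemeasurable, hcov]
    congr 1
    · exact hX.integral_dotProduct (A k)
    · simp [← NNReal.coe_mul]

theorem indepFun_mulVec [IsProbabilityMeasure μ] [Finite κ] [Finite κ']
    (hX : IsIIDGaussian μ v X) {A : Matrix κ ι ℝ} {B : Matrix κ' ι ℝ} (hAB : A * Bᵀ = 0) :
    IndepFun (fun ω => A *ᵥ X ω) (fun ω => B *ᵥ X ω) μ := by
  have := Fintype.ofFinite κ
  have := Fintype.ofFinite κ'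
  have hG : HasGaussianLaw (fun ω => (A *ᵥ X ω, B *ᵥ X ω)) μ :=
    (hX.indep.hasGaussianLaw fun i => (hX.law i).hasGaussianLaw).map_fun
      ((LinearMap.toContinuousLinearMap A.mulVecLin).prod
        (LinearMap.toContinuousLinearMap B.mulVecLin))
  refine hG.indepFun_of_covariance_eval fun k l => ?_
  have : A k ⬝ᵥ B l = 0 := congrFun₂ hAB k l
  exact (hX.covariance_dotProduct _ _).trans (by rw [this, mul_zero])

theorem indepFun_one_sub_mulVec [IsProbabilityMeasure μ] [Fintype κ] [DecidableEq κ]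
    [DecidableEq ι] (hX : IsIIDGaussian μ v X) {A : Matrix κ ι ℝ} {w : ℝ} (hw : w ≠ 0)
    (hA : A * Aᵀ = w • (1 : Matrix κ κ ℝ)) :
    IndepFun (fun ω => (1 - w⁻¹ • (Aᵀ * A)) *ᵥ X ω) (fun ω => A *ᵥ X ω) μ := by
  refine hX.indepFun_mulVec ?_
  rw [Matrix.sub_mul, Matrix.smul_mul, Matrix.mul_assoc, hA]
  simp [smul_smul, hw]

end IsIIDGaussian

theorem measure_le_of_indepFun {Ω α β : Type*} [MeasurableSpace Ω] {μ : Measure Ω}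
    [IsProbabilityMeasure μ] [MeasurableSpace α] [MeasurableSpace β]
    {X : Ω → α} {Y : Ω → β} (hX : AEMeasurable X μ) (hY : AEMeasurable Y μ) (h : IndepFun X Y μ)
    {B : Set (α × β)} (hB : MeasurableSet B) {p : ℝ}
    (hBp : ∀ y, μ.real {ω | (X ω, y) ∈ B} ≤ p) :
    μ.real {ω | (X ω, Y ω) ∈ B} ≤ p := by
  obtain ⟨ω⟩ := nonempty_of_isProbabilityMeasure μ
  have hp : 0 ≤ p := measureReal_nonneg.trans (hBp (Y ω))
  have hprob : IsProbabilityMeasure (μ.map Y) := Measure.isProbabilityMeasure_map hY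
  have hfib (y : β) : μ.map X ((fun x => (x, y)) ⁻¹' B) ≤ ENNReal.ofReal p := by
    rw [Measure.map_apply_of_aemeasurable hX (measurable_prodMk_right hB),
      ENNReal.le_ofReal_iff_toReal_le (measure_ne_top _ _) hp]
    exact hBp y
  refine ENNReal.toReal_le_of_le_ofReal hp ?_
  calc μ {ω | (X ω, Y ω) ∈ B} = (μ.map fun ω => (X ω, Y ω)) B :=
        (Measure.map_apply_of_aemeasurable (hX.prodMk hY) hB).symm
    _ = ∫⁻ y, μ.map X ((fun x => (x, y)) ⁻¹' B) ∂(μ.map Y) := by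
        rw [(indepFun_iff_map_prod_eq_prod_map_map hX hY).1 h, Measure.prod_apply_symm hB]
    _ ≤ ∫⁻ _, ENNReal.ofReal p ∂(μ.map Y) := lintegral_mono hfib
    _ = ENNReal.ofReal p := by simp

end Gaussian

section DotProduct

variable {ι : Type*} [Fintype ι] {u : ι → ℝ}

theorem dotProduct_self_nonneg (u : ι → ℝ) : 0 ≤ u ⬝ᵥ u := by
  simpa using dotProduct_star_self_nonneg u

theorem dotProduct_self_pos (hu : u ≠ 0) : 0 < u ⬝ᵥ u := by
  simpa using Matrix.dotProduct_star_self_pos_iff.2 hu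

end DotProduct

section Sketch

variable {s n : ℕ}

/-- The matrix of the linear map `A ↦ A *ᵥ g` acting on the entries of an `s × n` matrix `A`. -/
def applyMat (s : ℕ) (g : Fin n → ℝ) : Matrix (Fin s) (Fin s × Fin n) ℝ :=
  Matrix.of fun i p => if p.1 = i then g p.2 else 0

theorem applyMat_mulVec_matEntries (g : Fin n → ℝ) (A : Matrix (Fin s) (Fin n) ℝ) :
    applyMat s g *ᵥ matEntries A = A *ᵥ g := by
  ext i
  simp [applyMat, matEntries, Matrix.mulVec, dotProduct, Fintype.sum_prod_type,
    Finset.sum_ite_irrel, mul_comm]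

theorem applyMat_transpose_mulVec (g : Fin n → ℝ) (b : Fin s → ℝ) :
    (applyMat s g)ᵀ *ᵥ b = matEntries (Matrix.vecMulVec b g) := by
  ext p
  simp [applyMat, matEntries, Matrix.mulVec, dotProduct, Matrix.vecMulVec_apply, mul_comm]

theorem applyMat_mul_transpose (g : Fin n → ℝ) :
    applyMat s g * (applyMat s g)ᵀ = (g ⬝ᵥ g) • (1 : Matrix (Fin s) (Fin s) ℝ) := by
  ext i j
  simp [applyMat, Matrix.mul_apply, Fintype.sum_prod_type, Matrix.one_apply, dotProduct,
    Finset.sum_ite_irrel, eq_comm]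

/-- The part of `A` that acts on the orthogonal complement of `g`. -/
noncomputable def orthResidual (A : Matrix (Fin s) (Fin n) ℝ) (g : Fin n → ℝ) :
    Matrix (Fin s) (Fin n) ℝ :=
  A - (g ⬝ᵥ g)⁻¹ • Matrix.vecMulVec (A *ᵥ g) g

theorem matEntries_orthResidual (A : Matrix (Fin s) (Fin n) ℝ) (g : Fin n → ℝ) :
    matEntries (orthResidual A g)
      = (1 - (g ⬝ᵥ g)⁻¹ • ((applyMat s g)ᵀ * applyMat s g)) *ᵥ matEntries A := by
  rw [Matrix.sub_mulVec, Matrix.one_mulVec, Matrix.smul_mulVec, ← Matrix.mulVec_mulVec,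
    applyMat_mulVec_matEntries, applyMat_transpose_mulVec]
  rfl

theorem orthResidual_transpose_mulVec (A : Matrix (Fin s) (Fin n) ℝ) (g : Fin n → ℝ)
    (u : Fin s → ℝ) :
    (orthResidual A g)ᵀ *ᵥ u = Aᵀ *ᵥ u - ((g ⬝ᵥ g)⁻¹ * ((A *ᵥ g) ⬝ᵥ u)) • g := by
  rw [orthResidual, Matrix.transpose_sub, Matrix.sub_mulVec, Matrix.transpose_smul,
    Matrix.smul_mulVec, Matrix.transpose_vecMulVec, Matrix.vecMulVec_mulVec,
    op_smul_eq_smul, smul_smul]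

theorem orthResidual_transpose_mulVec_dotProduct_self (A : Matrix (Fin s) (Fin n) ℝ) (g : Fin n → ℝ)
    (u : Fin s → ℝ) :
    ((orthResidual A g)ᵀ *ᵥ u) ⬝ᵥ ((orthResidual A g)ᵀ *ᵥ u)
      = (Aᵀ *ᵥ u) ⬝ᵥ (Aᵀ *ᵥ u) - (g ⬝ᵥ g)⁻¹ * ((A *ᵥ g) ⬝ᵥ u) ^ 2 := by
  have hcross : (Aᵀ *ᵥ u) ⬝ᵥ g = (A *ᵥ g) ⬝ᵥ u := by
    rw [dotProduct_comm, Matrix.dotProduct_mulVec, Matrix.vecMul_transpose]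
  have hinv : (g ⬝ᵥ g)⁻¹ * (g ⬝ᵥ g)⁻¹ * (g ⬝ᵥ g) = (g ⬝ᵥ g)⁻¹ := by
    rcases eq_or_ne (g ⬝ᵥ g) 0 with h | h
    · simp [h]
    · field_simp
  simp only [orthResidual_transpose_mulVec, sub_dotProduct, dotProduct_sub, smul_dotProduct,
    dotProduct_smul, smul_eq_mul, hcross, dotProduct_comm g]
  linear_combination ((A *ᵥ g) ⬝ᵥ u) ^ 2 * hinv

/-- The two properties of a sketching matrix `P` that make a subspace step along `Pᵀ` reduce a
quadratic model with gradient `g`: `P` does not shrink `g` too much, and `Pᵀ` does not stretch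
`P g` too much, `T` being the squared stretch that is allowed orthogonally to `g`. -/
structure IsWellSketched (T : ℝ) (P : Matrix (Fin s) (Fin n) ℝ) (g : Fin n → ℝ) : Prop where
  lower : g ⬝ᵥ g ≤ 2 * ((P *ᵥ g) ⬝ᵥ (P *ᵥ g))
  upper : (g ⬝ᵥ g) * ((Pᵀ *ᵥ (P *ᵥ g)) ⬝ᵥ (Pᵀ *ᵥ (P *ᵥ g)))
    ≤ ((P *ᵥ g) ⬝ᵥ (P *ᵥ g)) * ((P *ᵥ g) ⬝ᵥ (P *ᵥ g) + T * (g ⬝ᵥ g))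

theorem isWellSketched_zero (T : ℝ) (P : Matrix (Fin s) (Fin n) ℝ) : IsWellSketched T P 0 := by
  constructor <;> simp

theorem isWellSketched_of_orthResidual {T : ℝ} {P : Matrix (Fin s) (Fin n) ℝ} {g : Fin n → ℝ}
    (hg : g ≠ 0) (hlower : g ⬝ᵥ g ≤ 2 * ((P *ᵥ g) ⬝ᵥ (P *ᵥ g)))
    (hres : ((orthResidual P g)ᵀ *ᵥ (P *ᵥ g)) ⬝ᵥ ((orthResidual P g)ᵀ *ᵥ (P *ᵥ g))
      ≤ T * ((P *ᵥ g) ⬝ᵥ (P *ᵥ g))) : IsWellSketched T P g := by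
  refine ⟨hlower, ?_⟩
  have hG : 0 < g ⬝ᵥ g := dotProduct_self_pos hg
  rw [orthResidual_transpose_mulVec_dotProduct_self] at hres
  have hmul := mul_le_mul_of_nonneg_left hres hG.le
  rw [mul_sub, mul_inv_cancel_left₀ hG.ne'] at hmul
  linarith

theorem isClosed_setOf_isWellSketched (T : ℝ) :
    IsClosed {z : Matrix (Fin s) (Fin n) ℝ × (Fin n → ℝ) | IsWellSketched T z.1 z.2} := by
  have hiff : ∀ (P : Matrix (Fin s) (Fin n) ℝ) (g : Fin n → ℝ), IsWellSketched T P g ↔ _ ∧ _ :=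
    fun P g => ⟨fun h => ⟨h.lower, h.upper⟩, fun h => ⟨h.1, h.2⟩⟩
  simp only [hiff, Set.ofPred_and]
  exact (isClosed_le (by fun_prop) (by fun_prop)).inter (isClosed_le (by fun_prop) (by fun_prop))

end Sketch

theorem IsIIDGaussian.matrix_mulVec {Ω : Type*} [MeasurableSpace Ω] {μ : Measure Ω}
    [IsProbabilityMeasure μ] {s n : ℕ} {v : NNReal} {P : Ω → Matrix (Fin s) (Fin n) ℝ}
    (hP : IsIIDGaussian μ v (fun ω => matEntries (P ω))) (g : Fin n → ℝ) :
    IsIIDGaussian μ (v * (g ⬝ᵥ g).toNNReal) (fun ω => P ω *ᵥ g) := by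
  simpa only [applyMat_mulVec_matEntries] using hP.mulVec (A := applyMat s g)
    (by rw [applyMat_mul_transpose, Real.coe_toNNReal _ (dotProduct_self_nonneg g)])

namespace IsGaussianMatrix

variable {Ω : Type*} [MeasurableSpace Ω] {μ : Measure Ω} {s n : ℕ}
  {P : Ω → Matrix (Fin s) (Fin n) ℝ}

theorem isIIDGaussian (hP : IsGaussianMatrix μ P) :
    IsIIDGaussian μ (s : NNReal)⁻¹ (fun ω => matEntries (P ω)) :=
  ⟨hP.indep, fun p => hP.law p.1 p.2⟩

theorem isIIDGaussian_transpose (hP : IsGaussianMatrix μ P) :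
    IsIIDGaussian μ (s : NNReal)⁻¹ (fun ω => matEntries (P ω)ᵀ) :=
  hP.isIIDGaussian.reindex Prod.swap_injective

variable [IsProbabilityMeasure μ]

theorem measure_mulVec_lt_le [NeZero s] (hP : IsGaussianMatrix μ P) (g : Fin n → ℝ) :
    μ.real {ω | 2 * ((P ω *ᵥ g) ⬝ᵥ (P ω *ᵥ g)) < g ⬝ᵥ g} ≤ Real.exp (-(1 / 20) * s) := by
  rcases eq_or_ne g 0 with rfl | hg
  · simp [Real.exp_nonneg]
  have hG := dotProduct_self_pos hg
  have hs : (s : ℝ) ≠ 0 := NeZero.ne _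
  have htail := (hP.isIIDGaussian.matrix_mulVec g).measure_dotProduct_self_le_le
    (mul_ne_zero (by simp [NeZero.ne s]) (by simpa using hG))
  rw [Fintype.card_fin] at htail
  refine (measureReal_mono fun ω hω => ?_).trans htail
  simp only [Set.mem_ofPred_eq, NNReal.coe_mul, NNReal.coe_inv, NNReal.coe_natCast,
    Real.coe_toNNReal _ hG.le] at hω ⊢
  field_simp
  linarith

theorem measure_transpose_mulVec_gt_le [NeZero s] (hP : IsGaussianMatrix μ P) (u : Fin s → ℝ) :
    μ.real {ω | (3 / 2 * (n / s) + 1 / 5) * (u ⬝ᵥ u) < ((P ω)ᵀ *ᵥ u) ⬝ᵥ ((P ω)ᵀ *ᵥ u)}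
      ≤ Real.exp (-(1 / 20) * s) := by
  rcases eq_or_ne u 0 with rfl | hu
  · simp [Real.exp_nonneg]
  have hU := dotProduct_self_pos hu
  have hs : (s : ℝ) ≠ 0 := NeZero.ne _
  have htail := (hP.isIIDGaussian_transpose.matrix_mulVec u).measure_le_dotProduct_self_le
    (mul_ne_zero (by simp [NeZero.ne s]) (by simpa using hU)) (1 / 20 * s)
  rw [Fintype.card_fin, ← neg_mul] at htail
  refine (measureReal_mono fun ω hω => ?_).trans htail
  simp only [Set.mem_ofPred_eq, NNReal.coe_mul, NNReal.coe_inv, NNReal.coe_natCast,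
    Real.coe_toNNReal _ hU.le] at hω ⊢
  refine (le_of_eq ?_).trans hω.le
  field_simp
  ring

theorem indepFun_orthResidual (hP : IsGaussianMatrix μ P) {g : Fin n → ℝ} (hg : g ≠ 0) :
    IndepFun (fun ω => matEntries (orthResidual (P ω) g)) (fun ω => P ω *ᵥ g) μ := by
  simpa only [matEntries_orthResidual, applyMat_mulVec_matEntries] using
    hP.isIIDGaussian.indepFun_one_sub_mulVec (dotProduct_self_pos hg).ne'
      (applyMat_mul_transpose (s := s) g)

-- `Pᵀ (P g)` is controlled without a bound on the operator norm of `P`: the part of `P` that acts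
-- orthogonally to `g` is independent of `P g`, so that `P g` may be treated as a fixed vector.
theorem measure_orthResidual_transpose_mulVec_gt_le [NeZero s] (hP : IsGaussianMatrix μ P)
    {g : Fin n → ℝ} (hg : g ≠ 0) :
    μ.real {ω | (3 / 2 * (n / s) + 1 / 5) * ((P ω *ᵥ g) ⬝ᵥ (P ω *ᵥ g))
        < ((orthResidual (P ω) g)ᵀ *ᵥ (P ω *ᵥ g)) ⬝ᵥ ((orthResidual (P ω) g)ᵀ *ᵥ (P ω *ᵥ g))}
      ≤ Real.exp (-(1 / 20) * s) := by
  have hres : AEMeasurable (fun ω => matEntries (orthResidual (P ω) g)) μ := by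
    simpa only [matEntries_orthResidual] using
      (hP.isIIDGaussian.hasGaussianLaw_mulVec _).aemeasurable
  refine measure_le_of_indepFun (B := {z : (Fin s × Fin n → ℝ) × (Fin s → ℝ) |
      (3 / 2 * (n / s) + 1 / 5) * (z.2 ⬝ᵥ z.2) <
        ((Matrix.of (Function.curry z.1))ᵀ *ᵥ z.2) ⬝ᵥ ((Matrix.of (Function.curry z.1))ᵀ *ᵥ z.2)})
    hres (hP.isIIDGaussian.matrix_mulVec g).aemeasurable (hP.indepFun_orthResidual hg) ?_
    fun b => ?_
  · have hcont : Continuous fun z : (Fin s × Fin n → ℝ) × (Fin s → ℝ) =>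
        (Matrix.of (Function.curry z.1) : Matrix (Fin s) (Fin n) ℝ) :=
      continuous_matrix fun i j => (continuous_apply (i, j)).comp continuous_fst
    exact (isOpen_lt (by fun_prop) (by fun_prop)).measurableSet
  · refine le_trans (measureReal_mono fun ω hω => ?_) (hP.measure_transpose_mulVec_gt_le b)
    calc (3 / 2 * (n / s) + 1 / 5) * (b ⬝ᵥ b)
        < ((orthResidual (P ω) g)ᵀ *ᵥ b) ⬝ᵥ ((orthResidual (P ω) g)ᵀ *ᵥ b) := hω
      _ = ((P ω)ᵀ *ᵥ b) ⬝ᵥ ((P ω)ᵀ *ᵥ b) - (g ⬝ᵥ g)⁻¹ * ((P ω *ᵥ g) ⬝ᵥ b) ^ 2 :=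
          orthResidual_transpose_mulVec_dotProduct_self _ _ _
      _ ≤ ((P ω)ᵀ *ᵥ b) ⬝ᵥ ((P ω)ᵀ *ᵥ b) :=
          sub_le_self _ (mul_nonneg (inv_nonneg.2 (dotProduct_self_nonneg g)) (sq_nonneg _))

theorem measure_not_isWellSketched_le [NeZero s] (hP : IsGaussianMatrix μ P) (g : Fin n → ℝ) :
    μ.real {ω | ¬ IsWellSketched (3 / 2 * (n / s) + 1 / 5) (P ω) g}
      ≤ 2 * Real.exp (-(1 / 20) * s) := by
  rcases eq_or_ne g 0 with rfl | hg
  · simp [isWellSketched_zero, Real.exp_nonneg]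
  refine (measureReal_mono ?_).trans ((measureReal_union_le _ _).trans ((add_le_add
    (hP.measure_mulVec_lt_le g) (hP.measure_orthResidual_transpose_mulVec_gt_le hg)).trans_eq
      (two_mul _).symm))
  intro ω hω
  by_contra h
  simp only [Set.mem_union, Set.mem_ofPred_eq, not_or, not_lt] at h
  exact hω (isWellSketched_of_orthResidual hg h.1 h.2)

end IsGaussianMatrix

section Subproblem

variable {ι : Type*} [Fintype ι] {M : Matrix ι ι ℝ} {u₀ : ι → ℝ}

theorem sq_dotProduct_mulVec_le (hM : M.PosSemidef) (x y : ι → ℝ) :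
    (x ⬝ᵥ M *ᵥ y) ^ 2 ≤ (x ⬝ᵥ M *ᵥ x) * (y ⬝ᵥ M *ᵥ y) := by
  classical
  have hsymm : y ⬝ᵥ M *ᵥ x = x ⬝ᵥ M *ᵥ y := by
    have hMT : M.IsSymm := by simpa using hM.1
    rw [Matrix.dotProduct_mulVec, ← Matrix.mulVec_transpose, hMT.eq, dotProduct_comm]
  have h := (Matrix.toBilin' M).apply_mul_apply_le_of_forall_zero_le
    (fun z => by simpa [Matrix.toBilin'_apply'] using hM.dotProduct_mulVec_nonneg z) x y
  simpa only [Matrix.toBilin'_apply', hsymm, ← pow_two] using h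

theorem mul_dotProduct_self_le_of_isMinOn
    (hmin : IsMinOn (fun u => u ⬝ᵥ M *ᵥ u) {u | u ⬝ᵥ u ≤ 1} u₀) (u : ι → ℝ) :
    (u₀ ⬝ᵥ M *ᵥ u₀) * (u ⬝ᵥ u) ≤ u ⬝ᵥ M *ᵥ u := by
  rcases eq_or_ne u 0 with rfl | hu
  · simp
  have hpos := dotProduct_self_pos hu
  have hscale : (√(u ⬝ᵥ u))⁻¹ * (√(u ⬝ᵥ u))⁻¹ = (u ⬝ᵥ u)⁻¹ := by
    rw [← mul_inv, Real.mul_self_sqrt hpos.le]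
  have hle := hmin (show (√(u ⬝ᵥ u))⁻¹ • u ∈ {u : ι → ℝ | u ⬝ᵥ u ≤ 1} by
    simp only [Set.mem_ofPred_eq, smul_dotProduct, dotProduct_smul, smul_eq_mul]
    rw [← mul_assoc, hscale, inv_mul_cancel₀ hpos.ne'])
  simp only [Set.mem_ofPred_eq, smul_dotProduct, dotProduct_smul, smul_eq_mul,
    Matrix.mulVec_smul] at hle
  rwa [← mul_assoc, hscale, inv_mul_eq_div, le_div_iff₀ hpos] at hle

theorem exists_mulVec_eq_neg_smul_of_isMinOn (hM : M.IsHermitian) (hu₀ : u₀ ⬝ᵥ u₀ ≤ 1)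
    (hmin : IsMinOn (fun u => u ⬝ᵥ M *ᵥ u) {u | u ⬝ᵥ u ≤ 1} u₀) (hneg : u₀ ⬝ᵥ M *ᵥ u₀ < 0) :
    ∃ θ : ℝ, 0 < θ ∧ M *ᵥ u₀ = -(θ • u₀) := by
  classical
  set θ := -(u₀ ⬝ᵥ M *ᵥ u₀) with hθ
  have hform (u : ι → ℝ) : u ⬝ᵥ (M + θ • (1 : Matrix ι ι ℝ)) *ᵥ u
      = u ⬝ᵥ M *ᵥ u - (u₀ ⬝ᵥ M *ᵥ u₀) * (u ⬝ᵥ u) := by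
    simp only [Matrix.add_mulVec, Matrix.smul_mulVec, Matrix.one_mulVec, dotProduct_add,
      dotProduct_smul, smul_eq_mul]
    rw [hθ]
    ring
  have hpsd : (M + θ • (1 : Matrix ι ι ℝ)).PosSemidef := by
    refine .of_dotProduct_mulVec_nonneg (hM.add (by simp [Matrix.IsHermitian])) fun u => ?_
    rw [star_trivial, hform, sub_nonneg]
    exact mul_dotProduct_self_le_of_isMinOn hmin u
  have hker : (M + θ • (1 : Matrix ι ι ℝ)) *ᵥ u₀ = 0 := by
    rw [← hpsd.dotProduct_mulVec_zero_iff]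
    refine le_antisymm ?_ (hpsd.dotProduct_mulVec_nonneg u₀)
    rw [star_trivial, hform]
    nlinarith
  refine ⟨θ, neg_pos.2 hneg, eq_neg_of_add_eq_zero_left ?_⟩
  simpa [Matrix.add_mulVec, Matrix.smul_mulVec] using hker

variable {s n : ℕ}

theorem homMat_mulVec_homVec (H : Matrix (Fin s) (Fin s) ℝ) (g : Fin s → ℝ) (δ : ℝ)
    (v : Fin s → ℝ) (t : ℝ) :
    homMat H g δ *ᵥ homVec v t = homVec (H *ᵥ v + t • g) (g ⬝ᵥ v - δ * t) := by
  ext (i | i) <;>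
    simp [homMat, homVec, Matrix.mulVec, dotProduct, Fintype.sum_sum_type, mul_comm, sub_eq_add_neg]

theorem homVec_dotProduct_homVec (v v' : Fin s → ℝ) (t t' : ℝ) :
    homVec v t ⬝ᵥ homVec v' t' = v ⬝ᵥ v' + t * t' := by
  simp [homVec, dotProduct, Fintype.sum_sum_type]

theorem isHermitian_homMat {H : Matrix (Fin s) (Fin s) ℝ} (hH : H.IsHermitian) (g : Fin s → ℝ)
    (δ : ℝ) : (homMat H g δ).IsHermitian := by
  rw [homMat, Matrix.isHermitian_fromBlocks_iff]
  refine ⟨hH, ?_, ?_, ?_⟩ <;> ext <;> simp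

/-- The vector `w` for which the RSHTR direction is `d = Pᵀ w`: the subspace coordinates of the
direction. -/
noncomputable def subspaceDir (v : Fin s → ℝ) (t : ℝ) : Fin s → ℝ :=
  if t ≠ 0 then t⁻¹ • v else v

theorem rshtrDir_eq (P : Matrix (Fin s) (Fin n) ℝ) (v : Fin s → ℝ) (t : ℝ) :
    (rshtrDir P v t).ofLp = Pᵀ *ᵥ subspaceDir v t := by
  unfold rshtrDir subspaceDir
  split_ifs <;> simp [Matrix.mulVec_smul]

namespace IsSubproblemSol

variable {A : Matrix (Fin s) (Fin s) ℝ} {b v : Fin s → ℝ} {t : ℝ}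

theorem dotProduct_homMat_mulVec_neg (h : IsSubproblemSol A b 0 v t) (hA : A.IsHermitian)
    (hb : b ≠ 0) : homVec v t ⬝ᵥ homMat A b 0 *ᵥ homVec v t < 0 := by
  by_contra! hnonneg
  have hpsd : (homMat A b 0).PosSemidef :=
    .of_dotProduct_mulVec_nonneg (isHermitian_homMat hA b 0) fun u =>
      (mul_nonneg hnonneg (dotProduct_self_nonneg u)).trans
        (mul_dotProduct_self_le_of_isMinOn h.2 u)
  have hker := (hpsd.dotProduct_mulVec_zero_iff (homVec 0 1)).1
    (by simp [homMat_mulVec_homVec, homVec_dotProduct_homVec])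
  refine hb (funext fun i => ?_)
  rw [homMat_mulVec_homVec] at hker
  simpa [homVec] using congrFun hker (Sum.inl i)

theorem exists_multiplier_of_ne_zero (h : IsSubproblemSol A b 0 v t) (hA : A.PosSemidef)
    (hb : b ≠ 0) : t ≠ 0 ∧ ∃ θ : ℝ, 0 < θ ∧ A *ᵥ v + t • b = -(θ • v) ∧ b ⬝ᵥ v = -(θ * t) := by
  have hneg := h.dotProduct_homMat_mulVec_neg hA.1 hb
  obtain ⟨θ, hθ, heig⟩ :=
    exists_mulVec_eq_neg_smul_of_isMinOn (isHermitian_homMat hA.1 b 0) h.1 h.2 hneg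
  rw [homMat_mulVec_homVec] at heig
  have htop : A *ᵥ v + t • b = -(θ • v) := by
    ext i
    simpa [homVec] using congrFun heig (Sum.inl i)
  have hbot : b ⬝ᵥ v = -(θ * t) := by
    simpa [homVec] using congrFun heig (Sum.inr ())
  refine ⟨?_, θ, hθ, htop, hbot⟩
  rintro rfl
  have hvAv := hA.dotProduct_mulVec_nonneg v
  rw [homMat_mulVec_homVec, homVec_dotProduct_homVec] at hneg
  simp only [star_trivial, zero_smul, add_zero, zero_mul] at hvAv hneg
  exact hneg.not_ge hvAv

theorem exists_multiplier (h : IsSubproblemSol A b 0 v t) (hA : A.PosSemidef) :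
    ∃ θ : ℝ, 0 ≤ θ ∧ A *ᵥ subspaceDir v t + θ • subspaceDir v t = -b ∧
      b ⬝ᵥ subspaceDir v t = -θ := by
  rcases eq_or_ne b 0 with rfl | hb
  · have hle : v ⬝ᵥ A *ᵥ v ≤ 0 := by
      have h0 := h.2 (show (0 : Fin s ⊕ Unit → ℝ) ∈ _ by simp)
      simpa [homMat_mulVec_homVec, homVec_dotProduct_homVec] using h0
    have hker : A *ᵥ v = 0 :=
      (hA.dotProduct_mulVec_zero_iff v).1 (hle.antisymm (hA.dotProduct_mulVec_nonneg v))
    refine ⟨0, le_rfl, ?_, by simp⟩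
    unfold subspaceDir
    split_ifs <;> simp [Matrix.mulVec_smul, hker]
  · obtain ⟨ht, θ, hθ, htop, hbot⟩ := h.exists_multiplier_of_ne_zero hA hb
    refine ⟨θ, hθ.le, ?_, ?_⟩
    · rw [subspaceDir, if_pos ht, Matrix.mulVec_smul, eq_sub_of_add_eq htop, smul_sub, smul_neg,
        inv_smul_smul₀ ht, smul_comm]
      abel
    · rw [subspaceDir, if_pos ht, dotProduct_smul, hbot, smul_eq_mul]
      field_simp

-- Cauchy-Schwarz for `A + θ`, for which the direction is the Newton direction.
theorem exists_multiplier_bounds (h : IsSubproblemSol A b 0 v t) (hA : A.PosSemidef) :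
    ∃ θ : ℝ, 0 ≤ θ ∧ b ⬝ᵥ subspaceDir v t = -θ ∧
      subspaceDir v t ⬝ᵥ A *ᵥ subspaceDir v t ≤ θ ∧
      (b ⬝ᵥ b) ^ 2 ≤ θ * (b ⬝ᵥ A *ᵥ b + θ * (b ⬝ᵥ b)) := by
  obtain ⟨θ, hθ, hnewton, hbw⟩ := h.exists_multiplier hA
  have hreg (x y : Fin s → ℝ) : x ⬝ᵥ (A + θ • (1 : Matrix (Fin s) (Fin s) ℝ)) *ᵥ y
      = x ⬝ᵥ A *ᵥ y + θ * (x ⬝ᵥ y) := by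
    simp [Matrix.add_mulVec, Matrix.smul_mulVec]
  have hnewton' (x : Fin s → ℝ) :
      x ⬝ᵥ A *ᵥ subspaceDir v t + θ * (x ⬝ᵥ subspaceDir v t) = -(x ⬝ᵥ b) := by
    rw [← dotProduct_neg, ← hnewton, dotProduct_add, dotProduct_smul, smul_eq_mul]
  have henergy := hnewton' (subspaceDir v t)
  rw [dotProduct_comm _ b, hbw, neg_neg] at henergy
  refine ⟨θ, hθ, hbw, ?_, ?_⟩
  · linarith [mul_nonneg hθ (dotProduct_self_nonneg (subspaceDir v t))]
  · have hcs := sq_dotProduct_mulVec_le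
      (hA.add (Matrix.PosSemidef.one.smul hθ)) b (subspaceDir v t)
    rw [hreg, hreg, hreg, hnewton', henergy, neg_sq] at hcs
    linarith

theorem rshtrDir_bounds {P : Matrix (Fin s) (Fin n) ℝ} {H : Matrix (Fin n) (Fin n) ℝ}
    {g : Fin n → ℝ} (h : IsSubproblemSol (P * H * Pᵀ) (P *ᵥ g) 0 v t) (hH : H.PosSemidef) :
    ∃ θ : ℝ, 0 ≤ θ ∧ g ⬝ᵥ (rshtrDir P v t).ofLp = -θ ∧
      (rshtrDir P v t).ofLp ⬝ᵥ H *ᵥ (rshtrDir P v t).ofLp ≤ θ ∧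
      ((P *ᵥ g) ⬝ᵥ (P *ᵥ g)) ^ 2 ≤ θ * ((Pᵀ *ᵥ (P *ᵥ g)) ⬝ᵥ H *ᵥ (Pᵀ *ᵥ (P *ᵥ g))
        + θ * ((P *ᵥ g) ⬝ᵥ (P *ᵥ g))) := by
  have hform (x y : Fin s → ℝ) : x ⬝ᵥ (P * H * Pᵀ) *ᵥ y = (Pᵀ *ᵥ x) ⬝ᵥ H *ᵥ (Pᵀ *ᵥ y) := by
    rw [Matrix.mul_assoc, ← Matrix.mulVec_mulVec, Matrix.dotProduct_mulVec,
      ← Matrix.mulVec_transpose, Matrix.mulVec_mulVec]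
  obtain ⟨θ, hθ, hbw, henergy, hsq⟩ :=
    h.exists_multiplier_bounds (by simpa using hH.mul_mul_conjTranspose_same P)
  rw [hform] at henergy hsq
  refine ⟨θ, hθ, ?_, ?_, hsq⟩
  · rw [rshtrDir_eq, Matrix.dotProduct_mulVec, Matrix.vecMul_transpose, hbw]
  · rwa [rshtrDir_eq]

end IsSubproblemSol

end Subproblem

section Hessian

theorem contDiff_gradient {F : Type*} [NormedAddCommGroup F] [InnerProductSpace ℝ F]
    [CompleteSpace F] {f : F → ℝ} {k m : WithTop ℕ∞} (hf : ContDiff ℝ k f) (hmk : m + 1 ≤ k) :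
    ContDiff ℝ m (∇ f) :=
  (InnerProductSpace.toDual ℝ F).symm.contDiff.comp (hf.fderiv_right hmk)

variable {n : ℕ} {f : EuclideanSpace ℝ (Fin n) → ℝ}

theorem dotProduct_eq_inner (x y : EuclideanSpace ℝ (Fin n)) : x.ofLp ⬝ᵥ y.ofLp = inner ℝ x y := by
  simp [PiLp.inner_apply, dotProduct, mul_comm]

theorem hessMat_mulVec (x y : EuclideanSpace ℝ (Fin n)) :
    hessMat f x *ᵥ y.ofLp = (hessOp f x y).ofLp := by
  conv_rhs => rw [← (EuclideanSpace.basisFun (Fin n) ℝ).sum_repr y, map_sum]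
  ext i
  simp [hessMat, Matrix.mulVec, dotProduct, mul_comm]

theorem dotProduct_hessMat_mulVec (x y z : EuclideanSpace ℝ (Fin n)) :
    z.ofLp ⬝ᵥ hessMat f x *ᵥ y.ofLp = inner ℝ z (hessOp f x y) := by
  rw [hessMat_mulVec, dotProduct_eq_inner]

theorem matNorm_hessMat (x z : EuclideanSpace ℝ (Fin n)) :
    matNorm (hessMat f x) z = √(inner ℝ z (hessOp f x z)) := by
  rw [matNorm, dotProduct_hessMat_mulVec]

theorem inner_hessOp (x u w : EuclideanSpace ℝ (Fin n)) :
    inner ℝ (hessOp f x u) w = fderiv ℝ (fderiv ℝ f) x u w := by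
  have h : hessOp f x u = (InnerProductSpace.toDual ℝ (EuclideanSpace ℝ (Fin n))).symm
      (fderiv ℝ (fderiv ℝ f) x u) :=
    congrArg (fun D : EuclideanSpace ℝ (Fin n) →L[ℝ] EuclideanSpace ℝ (Fin n) => D u)
      ((InnerProductSpace.toDual ℝ (EuclideanSpace ℝ (Fin n))).symm.comp_fderiv (f := fderiv ℝ f))
  rw [h, InnerProductSpace.toDual_symm_apply]

theorem inner_hessOp_comm (hf : ContDiff ℝ 2 f) (x u w : EuclideanSpace ℝ (Fin n)) :
    inner ℝ (hessOp f x u) w = inner ℝ u (hessOp f x w) := by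
  rw [real_inner_comm (hessOp f x w), inner_hessOp, inner_hessOp]
  exact (hf.contDiffAt.isSymmSndFDerivAt (by simp)) u w

theorem isHermitian_hessMat (hf : ContDiff ℝ 2 f) (x : EuclideanSpace ℝ (Fin n)) :
    (hessMat f x).IsHermitian := by
  ext i j
  simpa [hessMat, EuclideanSpace.inner_single_left, EuclideanSpace.inner_single_right] using
    inner_hessOp_comm hf x (EuclideanSpace.single i 1) (EuclideanSpace.single j 1)

theorem posSemidef_hessMat (hf : ContDiff ℝ 2 f) {x : EuclideanSpace ℝ (Fin n)}
    (h : ∀ z, 0 ≤ inner ℝ z (hessOp f x z)) : (hessMat f x).PosSemidef :=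
  .of_dotProduct_mulVec_nonneg (isHermitian_hessMat hf x) fun u =>
    (h (WithLp.toLp 2 u)).trans_eq (dotProduct_hessMat_mulVec x _ (WithLp.toLp 2 u)).symm

end Hessian

section Eigenvalues

variable {n : ℕ} {A : Matrix (Fin n) (Fin n) ℝ}

theorem lambdaMin_mul_le (hA : A.IsHermitian) (z : Fin n → ℝ) :
    lambdaMin A * (z ⬝ᵥ z) ≤ z ⬝ᵥ A *ᵥ z := by
  have hpsd : (A - algebraMap ℝ _ (lambdaMin A)).PosSemidef := by
    rw [Matrix.posSemidef_iff_isHermitian_and_spectrum_nonneg]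
    refine ⟨hA.sub (by simp [Matrix.IsHermitian, Matrix.algebraMap_eq_diagonal]), ?_⟩
    rw [← spectrum.sub_singleton_eq]
    rintro _ ⟨y, hy, _, rfl, rfl⟩
    exact sub_nonneg.2 (csInf_le Matrix.finite_real_spectrum.bddBelow hy)
  simpa [Matrix.sub_mulVec, Algebra.algebraMap_eq_smul_one, Matrix.smul_mulVec] using
    hpsd.dotProduct_mulVec_nonneg z

theorem le_lambdaMax_mul (hA : A.IsHermitian) (z : Fin n → ℝ) :
    z ⬝ᵥ A *ᵥ z ≤ lambdaMax A * (z ⬝ᵥ z) := by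
  have hpsd : (algebraMap ℝ _ (lambdaMax A) - A).PosSemidef := by
    rw [Matrix.posSemidef_iff_isHermitian_and_spectrum_nonneg]
    refine ⟨.sub (by simp [Matrix.IsHermitian, Matrix.algebraMap_eq_diagonal]) hA, ?_⟩
    rw [← spectrum.singleton_sub_eq]
    rintro _ ⟨_, rfl, y, hy, rfl⟩
    exact sub_nonneg.2 (le_csSup Matrix.finite_real_spectrum.bddAbove hy)
  simpa [Matrix.sub_mulVec, Algebra.algebraMap_eq_smul_one, Matrix.smul_mulVec] using
    hpsd.dotProduct_mulVec_nonneg z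

theorem lambdaMin_mul_norm_sq_le {f : EuclideanSpace ℝ (Fin n) → ℝ} {x : EuclideanSpace ℝ (Fin n)}
    (hA : (hessMat f x).IsHermitian) (z : EuclideanSpace ℝ (Fin n)) :
    lambdaMin (hessMat f x) * ‖z‖ ^ 2 ≤ inner ℝ z (hessOp f x z) := by
  rw [← real_inner_self_eq_norm_sq, ← dotProduct_eq_inner z z, ← dotProduct_hessMat_mulVec]
  exact lambdaMin_mul_le hA z.ofLp

theorem le_lambdaMax_mul_norm_sq {f : EuclideanSpace ℝ (Fin n) → ℝ} {x : EuclideanSpace ℝ (Fin n)}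
    (hA : (hessMat f x).IsHermitian) (z : EuclideanSpace ℝ (Fin n)) :
    inner ℝ z (hessOp f x z) ≤ lambdaMax (hessMat f x) * ‖z‖ ^ 2 := by
  rw [← real_inner_self_eq_norm_sq, ← dotProduct_eq_inner z z, ← dotProduct_hessMat_mulVec]
  exact le_lambdaMax_mul hA z.ofLp

variable [NeZero n]

theorem lambdaMin_mem_spectrum (hA : A.IsHermitian) : lambdaMin A ∈ spectrum ℝ A := by
  refine Set.Nonempty.csInf_mem ?_ Matrix.finite_real_spectrum
  rw [hA.spectrum_real_eq_range_eigenvalues]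
  exact Set.range_nonempty _

theorem lambdaMin_pos (hA : A.PosDef) : 0 < lambdaMin A := by
  have hmem := lambdaMin_mem_spectrum hA.1
  rw [hA.1.spectrum_real_eq_range_eigenvalues] at hmem
  obtain ⟨i, hi⟩ := hmem
  exact hi ▸ hA.eigenvalues_pos i

theorem lambdaMin_le_lambdaMax (hA : A.IsHermitian) : lambdaMin A ≤ lambdaMax A :=
  le_csSup Matrix.finite_real_spectrum.bddAbove (lambdaMin_mem_spectrum hA)

end Eigenvalues

section Perturbation

theorem le_mul_of_sq_le {a β γ θ G T : ℝ} (ha : 0 ≤ a) (hβ : 0 ≤ β) (hT : 0 ≤ T) (hθ : 0 ≤ θ)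
    (hG : G ≤ 2 * β) (hγ : G * γ ≤ β * (β + T * G)) (h : β ^ 2 ≤ θ * (a * γ + θ * β))
    (hG0 : 0 ≤ G) : G ≤ θ * (a * (1 + 2 * T) + 2 * θ) := by
  rcases hβ.eq_or_lt with rfl | hβ
  · have : 0 ≤ θ * (a * (1 + 2 * T) + 2 * θ) := by positivity
    linarith
  have hβG : β * (β * G) ≤ β * (θ * (a * (β + T * G) + θ * G)) :=
    calc β * (β * G) = G * β ^ 2 := by ring
      _ ≤ G * (θ * (a * γ + θ * β)) := by gcongr
      _ = θ * a * (G * γ) + θ * β * θ * G := by ring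
      _ ≤ θ * a * (β * (β + T * G)) + θ * β * θ * G := by gcongr
      _ = β * (θ * (a * (β + T * G) + θ * G)) := by ring
  refine le_of_mul_le_mul_left ?_ hβ
  calc β * G ≤ θ * (a * (β + T * G) + θ * G) := le_of_mul_le_mul_left hβG hβ
    _ ≤ θ * (a * (β + T * (2 * β)) + θ * (2 * β)) := by gcongr
    _ = β * (θ * (a * (1 + 2 * T) + 2 * θ)) := by ring

variable {E : Type*} [NormedAddCommGroup E] [InnerProductSpace ℝ E]
  {A B : E →L[ℝ] E} {d e g : E} {m ε σ Λ : ℝ}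

theorem abs_inner_apply_sub_inner_apply_le (h : ‖B - A‖ ≤ ε) (z : E) :
    |inner ℝ z (B z) - inner ℝ z (A z)| ≤ ε * ‖z‖ ^ 2 :=
  calc |inner ℝ z (B z) - inner ℝ z (A z)| = |inner ℝ z ((B - A) z)| := by
        rw [← inner_sub_right, sub_apply]
    _ ≤ ‖z‖ * ‖(B - A) z‖ := abs_real_inner_le_norm _ _
    _ ≤ ‖z‖ * (ε * ‖z‖) := by gcongr; exact (B - A).le_of_opNorm_le h z
    _ = ε * ‖z‖ ^ 2 := by ring

theorem mul_norm_le_of_mul_norm_sq_le_inner {z w : E} (h : m * ‖z‖ ^ 2 ≤ inner ℝ z w) :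
    m * ‖z‖ ≤ ‖w‖ := by
  rcases eq_or_ne z 0 with rfl | hz
  · simp
  · refine le_of_mul_le_mul_left ?_ (norm_pos_iff.2 hz)
    linarith [real_inner_le_norm z w]

theorem mul_inner_apply_le_norm_sq (hm : 0 ≤ m) (hA : ∀ z, m * ‖z‖ ^ 2 ≤ inner ℝ z (A z)) (z : E) :
    m * inner ℝ z (A z) ≤ ‖A z‖ ^ 2 :=
  calc m * inner ℝ z (A z) ≤ m * (‖z‖ * ‖A z‖) := by gcongr; exact real_inner_le_norm _ _
    _ = m * ‖z‖ * ‖A z‖ := by ring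
    _ ≤ ‖A z‖ * ‖A z‖ := by gcongr; exact mul_norm_le_of_mul_norm_sq_le_inner (hA z)
    _ = ‖A z‖ ^ 2 := (sq _).symm

/-- At displacement `e` from a critical point with Hessian `A`, the gradient `g` and the Hessian
`B` agree up to `ε` with those of the quadratic function with Hessian `A`. -/
structure IsNearQuadratic (A : E →L[ℝ] E) (ε : ℝ) (e g : E) (B : E →L[ℝ] E) : Prop where
  norm_grad_sub_le : ‖g - A e‖ ≤ ε * ‖e‖
  norm_hess_sub_le : ‖B - A‖ ≤ ε
  norm_grad_le : ‖g‖ ≤ ε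

namespace IsNearQuadratic

theorem sub_mul_norm_sq_le (h : IsNearQuadratic A ε e g B)
    (hA : ∀ z, m * ‖z‖ ^ 2 ≤ inner ℝ z (A z)) (z : E) :
    (m - ε) * ‖z‖ ^ 2 ≤ inner ℝ z (B z) := by
  linarith [hA z, (abs_le.1 (abs_inner_apply_sub_inner_apply_le h.norm_hess_sub_le z)).1]

theorem le_add_mul_norm_sq (h : IsNearQuadratic A ε e g B)
    (hA : ∀ z, inner ℝ z (A z) ≤ Λ * ‖z‖ ^ 2) (z : E) :
    inner ℝ z (B z) ≤ (Λ + ε) * ‖z‖ ^ 2 := by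
  linarith [hA z, (abs_le.1 (abs_inner_apply_sub_inner_apply_le h.norm_hess_sub_le z)).2]

theorem norm_displacement_le (h : IsNearQuadratic A ε e g B) (hm : 0 < m) (hε : ε ≤ m / 2)
    (hA : ∀ z, m * ‖z‖ ^ 2 ≤ inner ℝ z (A z)) : ‖e‖ ≤ 2 * ‖g‖ / m := by
  have hAe := mul_norm_le_of_mul_norm_sq_le_inner (hA e)
  have hεe : ε * ‖e‖ ≤ m / 2 * ‖e‖ := by gcongr
  rw [le_div_iff₀ hm]
  linarith [norm_le_norm_add_norm_sub g (A e), h.norm_grad_sub_le]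

theorem norm_apply_le (h : IsNearQuadratic A ε e g B) (hm : 0 < m) (hε0 : 0 ≤ ε) (hε : ε ≤ m / 2)
    (hA : ∀ z, m * ‖z‖ ^ 2 ≤ inner ℝ z (A z)) : ‖A e‖ ≤ (1 + 2 * ε / m) * ‖g‖ :=
  calc ‖A e‖ ≤ ‖g‖ + ‖g - A e‖ := norm_le_norm_add_norm_sub g (A e)
    _ ≤ ‖g‖ + ε * ‖e‖ := by gcongr; exact h.norm_grad_sub_le
    _ ≤ ‖g‖ + ε * (2 * ‖g‖ / m) := by gcongr; exact h.norm_displacement_le hm hε hA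
    _ = (1 + 2 * ε / m) * ‖g‖ := by ring

theorem norm_dir_le (h : IsNearQuadratic A ε e g B) (hm : 0 < m) (hε : ε ≤ m / 2)
    (hA : ∀ z, m * ‖z‖ ^ 2 ≤ inner ℝ z (A z)) (hdB : inner ℝ d (B d) ≤ -inner ℝ g d) :
    ‖d‖ ≤ 2 * ‖g‖ / m := by
  have hd : m / 2 * ‖d‖ ≤ ‖-g‖ := mul_norm_le_of_mul_norm_sq_le_inner <|
    calc m / 2 * ‖d‖ ^ 2 ≤ (m - ε) * ‖d‖ ^ 2 := by gcongr; linarith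
      _ ≤ inner ℝ d (B d) := h.sub_mul_norm_sq_le hA d
      _ ≤ inner ℝ d (-g) := by rwa [inner_neg_right, real_inner_comm g d]
  rw [norm_neg] at hd
  rw [le_div_iff₀ hm]
  linarith

theorem neg_inner_le (h : IsNearQuadratic A ε e g B) (hm : 0 < m) (hε0 : 0 ≤ ε) (hε : ε ≤ m / 2)
    (hA : ∀ z, m * ‖z‖ ^ 2 ≤ inner ℝ z (A z)) (hdB : inner ℝ d (B d) ≤ -inner ℝ g d) :
    -inner ℝ g d ≤ ε :=
  calc -inner ℝ g d ≤ ‖g‖ * ‖d‖ := neg_le_of_neg_le (neg_le_of_abs_le (abs_real_inner_le_norm g d))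
    _ ≤ ε * (2 * (m / 2) / m) := by
      gcongr
      · exact h.norm_grad_le
      · refine (h.norm_dir_le hm hε hA hdB).trans ?_
        gcongr
        exact h.norm_grad_le.trans hε
    _ = ε := by field_simp

theorem inner_add_le (h : IsNearQuadratic A ε e g B)
    (hsymm : ∀ x y, inner ℝ (A x) y = inner ℝ x (A y))
    (hdB : inner ℝ d (B d) ≤ -inner ℝ g d) :
    inner ℝ (e + d) (A (e + d))
      ≤ inner ℝ e (A e) + inner ℝ g d + ε * (2 * (‖d‖ * ‖e‖) + ‖d‖ ^ 2) := by
  have hexpand : inner ℝ (e + d) (A (e + d))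
      = inner ℝ e (A e) + 2 * inner ℝ g d - 2 * inner ℝ d (g - A e) + inner ℝ d (A d) := by
    simp only [map_add, inner_add_left, inner_add_right, inner_sub_right]
    rw [← hsymm e d, real_inner_comm d (A e), real_inner_comm d g]
    ring
  have hgrad : -inner ℝ d (g - A e) ≤ ε * (‖d‖ * ‖e‖) :=
    calc -inner ℝ d (g - A e) ≤ ‖d‖ * ‖g - A e‖ :=
          neg_le_of_neg_le (neg_le_of_abs_le (abs_real_inner_le_norm _ _))
      _ ≤ ‖d‖ * (ε * ‖e‖) := by gcongr; exact h.norm_grad_sub_le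
      _ = ε * (‖d‖ * ‖e‖) := by ring
  have hhess := (abs_le.1 (abs_inner_apply_sub_inner_apply_le h.norm_hess_sub_le d)).1
  linarith

theorem inner_add_le_mul (h : IsNearQuadratic A ε e g B)
    (hsymm : ∀ x y, inner ℝ (A x) y = inner ℝ x (A y)) (hm : 0 < m) (hε0 : 0 < ε) (hε : ε ≤ m / 2)
    (hA : ∀ z, m * ‖z‖ ^ 2 ≤ inner ℝ z (A z)) (hdB : inner ℝ d (B d) ≤ -inner ℝ g d) {D : ℝ}
    (hD : 0 < D) (hgD : ‖g‖ ^ 2 ≤ -inner ℝ g d * D) (hσ0 : 0 ≤ σ)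
    (hσ : σ * (1 + 2 * ε / m) ^ 2 ≤ 1 / D - 12 * ε / m ^ 2) :
    inner ℝ (e + d) (A (e + d)) ≤ (1 - m * σ) * inner ℝ e (A e) := by
  have hd := h.norm_dir_le hm hε hA hdB
  have he := h.norm_displacement_le hm hε hA
  have hremainder : ε * (2 * (‖d‖ * ‖e‖) + ‖d‖ ^ 2) ≤ 12 * ε / m ^ 2 * ‖g‖ ^ 2 :=
    calc ε * (2 * (‖d‖ * ‖e‖) + ‖d‖ ^ 2)
        ≤ ε * (2 * (2 * ‖g‖ / m * (2 * ‖g‖ / m)) + (2 * ‖g‖ / m) ^ 2) := by gcongr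
      _ = 12 * ε / m ^ 2 * ‖g‖ ^ 2 := by ring
  have hdecrease : 1 / D * ‖g‖ ^ 2 ≤ -inner ℝ g d := by
    rwa [one_div_mul_eq_div, div_le_iff₀ hD]
  have hmodel : m * σ * inner ℝ e (A e) ≤ (1 / D - 12 * ε / m ^ 2) * ‖g‖ ^ 2 :=
    calc m * σ * inner ℝ e (A e) = σ * (m * inner ℝ e (A e)) := by ring
      _ ≤ σ * ‖A e‖ ^ 2 := by gcongr; exact mul_inner_apply_le_norm_sq hm.le hA e
      _ ≤ σ * ((1 + 2 * ε / m) * ‖g‖) ^ 2 := by gcongr; exact h.norm_apply_le hm hε0.le hε hA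
      _ = σ * (1 + 2 * ε / m) ^ 2 * ‖g‖ ^ 2 := by ring
      _ ≤ (1 / D - 12 * ε / m ^ 2) * ‖g‖ ^ 2 := by gcongr
  linarith [h.inner_add_le hsymm hdB]

end IsNearQuadratic

theorem eventually_mul_le_sub {c : ℝ} (hc : 0 < c) (hΛ : 0 < Λ) (hσ : σ < 1 / (Λ * c)) (m : ℝ) :
    ∀ᶠ ε in 𝓝 (0 : ℝ), σ * (1 + 2 * ε / m) ^ 2
      ≤ 1 / ((Λ + ε) * c + 2 * ε) - 12 * ε / m ^ 2 := by
  have hcont : ContinuousAt (fun ε : ℝ =>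
      1 / ((Λ + ε) * c + 2 * ε) - 12 * ε / m ^ 2 - σ * (1 + 2 * ε / m) ^ 2) 0 := by
    refine ((ContinuousAt.div (by fun_prop) (by fun_prop) ?_).sub (by fun_prop)).sub (by fun_prop)
    simpa using ⟨hΛ.ne', hc.ne'⟩
  filter_upwards [hcont.eventually (lt_mem_nhds (a := 0) (by simpa using hσ))] with ε hε
  linarith

end Perturbation

section Contraction

variable {n s : ℕ} {f : EuclideanSpace ℝ (Fin n) → ℝ} {x xbar : EuclideanSpace ℝ (Fin n)}

theorem eventually_isNearQuadratic (hf : ContDiff ℝ 2 f) (hgrad : ∇ f xbar = 0) {ε : ℝ}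
    (hε : 0 < ε) :
    ∀ᶠ x in 𝓝 xbar, IsNearQuadratic (hessOp f xbar) ε (x - xbar) (∇ f x) (hessOp f x) := by
  have hC : ContDiff ℝ 1 (∇ f) := contDiff_gradient hf (by norm_num)
  have hderiv : ∀ᶠ x in 𝓝 xbar, ‖∇ f x - hessOp f xbar (x - xbar)‖ ≤ ε * ‖x - xbar‖ := by
    simpa [hgrad, hessOp] using
      (hC.differentiable one_ne_zero xbar).hasFDerivAt.isLittleO.def hε
  have hhess : ∀ᶠ x in 𝓝 xbar, ‖hessOp f x - hessOp f xbar‖ < ε := by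
    simpa only [dist_eq_norm, hessOp] using
      Metric.tendsto_nhds.1 ((hC.continuous_fderiv one_ne_zero).tendsto xbar) ε hε
  have hsmall : ∀ᶠ x in 𝓝 xbar, ‖∇ f x‖ < ε := by
    simpa [hgrad] using Metric.tendsto_nhds.1 (hC.continuous.tendsto xbar) ε hε
  filter_upwards [hderiv, hhess, hsmall] with x h₁ h₂ h₃ using ⟨h₁, h₂.le, h₃.le⟩

theorem IsNearQuadratic.matNorm_add_rshtrDir_le [NeZero n] (hf : ContDiff ℝ 2 f)
    (hpd : (hessMat f xbar).PosDef) {ε σ T : ℝ}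
    (h : IsNearQuadratic (hessOp f xbar) ε (x - xbar) (∇ f x) (hessOp f x)) (hε0 : 0 < ε)
    (hε : ε ≤ lambdaMin (hessMat f xbar) / 2) (hT : 0 ≤ T) (hσ0 : 0 ≤ σ)
    (hσ : σ * (1 + 2 * ε / lambdaMin (hessMat f xbar)) ^ 2
      ≤ 1 / ((lambdaMax (hessMat f xbar) + ε) * (1 + 2 * T) + 2 * ε)
        - 12 * ε / lambdaMin (hessMat f xbar) ^ 2)
    {P : Matrix (Fin s) (Fin n) ℝ} {v : Fin s → ℝ} {t : ℝ}
    (hsol : IsSubproblemSol (P * hessMat f x * Pᵀ) (P *ᵥ (∇ f x).ofLp) 0 v t)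
    (hP : IsWellSketched T P (∇ f x).ofLp) :
    matNorm (hessMat f xbar) (x + rshtrDir P v t - xbar) ≤
      √(1 - lambdaMin (hessMat f xbar) * σ) * matNorm (hessMat f xbar) (x - xbar) := by
  set m := lambdaMin (hessMat f xbar)
  set Λ := lambdaMax (hessMat f xbar)
  have hm : 0 < m := lambdaMin_pos hpd
  have hΛ : 0 < Λ := hm.trans_le (lambdaMin_le_lambdaMax hpd.1)
  have hA := lambdaMin_mul_norm_sq_le hpd.1
  obtain ⟨θ, hθ, hgd, hdB, hsq⟩ := hsol.rshtrDir_bounds <| posSemidef_hessMat hf fun z =>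
    (mul_nonneg (by linarith) (sq_nonneg ‖z‖)).trans (h.sub_mul_norm_sq_le hA z)
  rw [dotProduct_eq_inner] at hgd
  rw [dotProduct_hessMat_mulVec] at hdB
  replace hdB := hdB.trans_eq (neg_eq_iff_eq_neg.2 hgd).symm
  have hθε := h.neg_inner_le hm hε0.le hε hA hdB
  have hsketch : (Pᵀ *ᵥ (P *ᵥ (∇ f x).ofLp)) ⬝ᵥ hessMat f x *ᵥ (Pᵀ *ᵥ (P *ᵥ (∇ f x).ofLp))
      ≤ (Λ + ε) * ((Pᵀ *ᵥ (P *ᵥ (∇ f x).ofLp)) ⬝ᵥ (Pᵀ *ᵥ (P *ᵥ (∇ f x).ofLp))) := by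
    set c := WithLp.toLp 2 (Pᵀ *ᵥ (P *ᵥ (∇ f x).ofLp))
    have := h.le_add_mul_norm_sq (le_lambdaMax_mul_norm_sq hpd.1) c
    rwa [← real_inner_self_eq_norm_sq, ← dotProduct_eq_inner c c,
      ← dotProduct_hessMat_mulVec] at this
  have hlower : ‖∇ f x‖ ^ 2 ≤ θ * ((Λ + ε) * (1 + 2 * T) + 2 * θ) := by
    rw [← real_inner_self_eq_norm_sq, ← dotProduct_eq_inner]
    exact le_mul_of_sq_le (by positivity) (dotProduct_self_nonneg _) hT hθ hP.lower hP.upper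
      (hsq.trans (by gcongr)) (dotProduct_self_nonneg _)
  rw [matNorm_hessMat, matNorm_hessMat, add_sub_right_comm, ← Real.sqrt_mul']
  · refine Real.sqrt_le_sqrt (h.inner_add_le_mul (inner_hessOp_comm hf xbar) hm hε0 hε hA hdB
      (by positivity) (hlower.trans ?_) hσ0 hσ)
    rw [hgd, neg_neg] at hθε ⊢
    gcongr
  · exact (by positivity : (0 : ℝ) ≤ m * ‖x - xbar‖ ^ 2).trans (hA _)

theorem eventually_matNorm_add_rshtrDir_le [NeZero n] (hf : ContDiff ℝ 2 f)
    (hgrad : ∇ f xbar = 0) (hpd : (hessMat f xbar).PosDef) {T τ : ℝ} (hT : 0 ≤ T)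
    (hτ : 1 + 2 * T < τ) :
    ∀ᶠ x in 𝓝 xbar, ∀ (P : Matrix (Fin s) (Fin n) ℝ) (v : Fin s → ℝ) (t : ℝ),
      IsSubproblemSol (P * hessMat f x * Pᵀ) (P *ᵥ (∇ f x).ofLp) 0 v t →
      IsWellSketched T P (∇ f x).ofLp →
      matNorm (hessMat f xbar) (x + rshtrDir P v t - xbar) ≤
        √(1 - 1 / (condNumber (hessMat f xbar) * τ)) * matNorm (hessMat f xbar) (x - xbar) := by
  have hm := lambdaMin_pos hpd
  have hΛ := hm.trans_le (lambdaMin_le_lambdaMax hpd.1)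
  have hσ : 1 / (lambdaMax (hessMat f xbar) * τ) < 1 / (lambdaMax (hessMat f xbar) * (1 + 2 * T)) :=
    one_div_lt_one_div_of_lt (by positivity) (by gcongr)
  have hsmall := ((eventually_mul_le_sub (by positivity) hΛ hσ (lambdaMin (hessMat f xbar))).and
    (ge_mem_nhds (half_pos hm))).filter_mono (nhdsWithin_le_nhds (s := Set.Ioi 0))
  obtain ⟨ε, ⟨hεσ, hεm⟩, hε⟩ := (hsmall.and self_mem_nhdsWithin).exists
  have hrate : 1 / (condNumber (hessMat f xbar) * τ)
      = lambdaMin (hessMat f xbar) * (1 / (lambdaMax (hessMat f xbar) * τ)) := by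
    rw [condNumber]
    field_simp
  filter_upwards [eventually_isNearQuadratic hf hgrad hε] with x hx P v t hsol hP
  rw [hrate]
  have hτ0 : 0 < τ := by linarith
  exact hx.matNorm_add_rshtrDir_le hf hpd hε hεm hT (by positivity) hεσ hsol hP

end Contraction

section Run

theorem measurable_rshtrDir {Ω : Type*} [MeasurableSpace Ω] {s n : ℕ}
    {P : Ω → Matrix (Fin s) (Fin n) ℝ} {v : Ω → Fin s → ℝ} {t : Ω → ℝ}
    (hP : Measurable fun ω => matEntries (P ω)) (hv : Measurable v) (ht : Measurable t) :
    Measurable fun ω => rshtrDir (P ω) (v ω) (t ω) := by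
  have hPv : Measurable fun ω => (P ω)ᵀ *ᵥ v ω := by
    refine measurable_pi_lambda _ fun j => ?_
    simp only [Matrix.mulVec, dotProduct, Matrix.transpose_apply]
    exact Finset.measurable_fun_sum _ fun i _ =>
      ((measurable_pi_apply (i, j)).comp hP).mul ((measurable_pi_apply i).comp hv)
  exact Measurable.ite (measurableSet_eq_fun ht measurable_const).compl
    ((WithLp.measurable_toLp 2 _).comp (ht.inv.smul hPv)) ((WithLp.measurable_toLp 2 _).comp hPv)

theorem measurable_rshtrStep {Ω : Type*} [MeasurableSpace Ω] {n : ℕ} (Δ : ℝ) {b : Ω → Bool}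
    {x d : Ω → EuclideanSpace ℝ (Fin n)} (hb : Measurable b) (hx : Measurable x)
    (hd : Measurable d) : Measurable fun ω => rshtrStep Δ (b ω) (x ω) (d ω) :=
  Measurable.ite
    ((hb (measurableSet_singleton true)).inter (measurableSet_lt measurable_const hd.norm))
    (hx.add ((hd.norm.const_div Δ).smul hd)) (hx.add hd)

namespace IsRSHTRRun

variable {n s : ℕ} {f : EuclideanSpace ℝ (Fin n) → ℝ} {δ Δ : ℝ} {Ω : Type*}
  [mΩ : MeasurableSpace Ω] {μ : Measure Ω} {ℱ : Filtration ℕ mΩ}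
  {P : ℕ → Ω → Matrix (Fin s) (Fin n) ℝ} {v : ℕ → Ω → Fin s → ℝ} {t : ℕ → Ω → ℝ}
  {gm : ℕ → Ω → Bool} {x : ℕ → Ω → EuclideanSpace ℝ (Fin n)} {xbar : EuclideanSpace ℝ (Fin n)}

theorem subproblem_of_mode_eq_false (h : IsRSHTRRun f δ Δ μ ℱ P v t gm x) {k : ℕ} {ω : Ω}
    (hmode : gm k ω = false) : IsSubproblemSol (P k ω * hessMat f (x k ω) * (P k ω)ᵀ)
      (P k ω *ᵥ (∇ f (x k ω)).ofLp) 0 (v k ω) (t k ω) := by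
  simpa [hmode] using h.subproblem k ω

theorem step_of_mode_eq_false (h : IsRSHTRRun f δ Δ μ ℱ P v t gm x) {k : ℕ} {ω : Ω}
    (hmode : gm k ω = false) :
    x (k + 1) ω = x k ω + rshtrDir (P k ω) (v k ω) (t k ω) := by
  simpa [hmode, rshtrStep] using h.step k ω

theorem measurable_dir (h : IsRSHTRRun f δ Δ μ ℱ P v t gm x) (k : ℕ) :
    Measurable[ℱ (k + 1)] fun ω => rshtrDir (P k ω) (v k ω) (t k ω) :=
  @measurable_rshtrDir Ω (ℱ (k + 1)) s n _ _ _ (h.measurable_mat k) (h.measurable_v k)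
    (h.measurable_t k)

theorem measurable_mode (h : IsRSHTRRun f δ Δ μ ℱ P v t gm x) (k : ℕ) :
    Measurable[ℱ k] (gm k) := by
  induction k with
  | zero =>
    rw [show gm 0 = fun _ => true from funext h.mode_zero]
    exact @measurable_const _ _ _ (ℱ 0) _
  | succ k ih =>
    have hpre : gm (k + 1) ⁻¹' {true} =
        gm k ⁻¹' {true} ∩ {ω | Δ < ‖rshtrDir (P k ω) (v k ω) (t k ω)‖} :=
      Set.ext (h.mode_succ k)
    refine @measurable_to_bool _ (ℱ (k + 1)) _ (hpre ▸ ?_)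
    exact @MeasurableSet.inter _ (ℱ (k + 1)) _ _
      ((ih.mono (ℱ.mono k.le_succ) le_rfl) (measurableSet_singleton true))
      ((continuous_norm.measurable.comp (h.measurable_dir k)) measurableSet_Ioi)

theorem measurable_iterate (h : IsRSHTRRun f δ Δ μ ℱ P v t gm x) (k : ℕ) :
    Measurable[ℱ k] (x k) := by
  induction k with
  | zero => exact h.measurable_init
  | succ k ih =>
    have hle : ℱ k ≤ ℱ (k + 1) := ℱ.mono k.le_succ
    rw [funext (h.step k)]
    exact @measurable_rshtrStep Ω (ℱ (k + 1)) n Δ _ _ _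
      ((h.measurable_mode k).mono hle le_rfl) (ih.mono hle le_rfl) (h.measurable_dir k)

theorem exists_mode_eq_false (h : IsRSHTRRun f δ Δ μ ℱ P v t gm x) (hΔ : 0 < Δ) {ω : Ω}
    (hx : Tendsto (fun k => x k ω) atTop (𝓝 xbar)) : ∃ k, gm k ω = false := by
  by_contra! hall
  simp only [ne_eq, Bool.not_eq_false] at hall
  have hnorm (k : ℕ) : ‖x (k + 1) ω - x k ω‖ = Δ := by
    have hlt := ((h.mode_succ k ω).1 (hall (k + 1))).2
    rw [h.step k ω, rshtrStep, if_pos ⟨hall k, hlt⟩, add_sub_cancel_left, norm_smul, norm_div,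
      norm_norm, Real.norm_of_nonneg hΔ.le, div_mul_cancel₀ _ (hΔ.trans hlt).ne']
  have hlim := ((hx.comp (tendsto_add_atTop_nat 1)).sub hx).norm
  simp only [Function.comp_def, hnorm, sub_self, norm_zero] at hlim
  exact hΔ.ne' (tendsto_nhds_unique tendsto_const_nhds hlim)

theorem eventually_mode_eq_false (h : IsRSHTRRun f δ Δ μ ℱ P v t gm x) (hΔ : 0 < Δ) {ω : Ω}
    (hx : Tendsto (fun k => x k ω) atTop (𝓝 xbar)) : ∀ᶠ k in atTop, gm k ω = false := by
  obtain ⟨K, hK⟩ := h.exists_mode_eq_false hΔ hx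
  refine eventually_atTop.2 ⟨K, fun k hk => ?_⟩
  induction k, hk using Nat.le_induction with
  | base => exact hK
  | succ k _ ih =>
    rw [← Bool.not_eq_true, h.mode_succ]
    simp [ih]

theorem tendsto_measure_not_local (h : IsRSHTRRun f δ Δ μ ℱ P v t gm x) [IsFiniteMeasure μ]
    (hΔ : 0 < Δ) (hx : ∀ᵐ ω ∂μ, Tendsto (fun k => x k ω) atTop (𝓝 xbar))
    {U : Set (EuclideanSpace ℝ (Fin n))} (hU : IsOpen U) (hxU : xbar ∈ U) :
    Tendsto (fun k => μ.real {ω | gm k ω = true ∨ x k ω ∉ U}) atTop (𝓝 0) := by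
  have hlim : ∀ᵐ ω ∂μ, ∀ᶠ k in atTop, ω ∈ {ω | gm k ω = true ∨ x k ω ∉ U} ↔ ω ∈ (∅ : Set Ω) := by
    filter_upwards [hx] with ω hω
    filter_upwards [h.eventually_mode_eq_false hΔ hω, hω (hU.mem_nhds hxU)] with k hk hkU
    simp [hk, Set.mem_preimage.1 hkU]
  have hmeas (k : ℕ) : MeasurableSet {ω | gm k ω = true ∨ x k ω ∉ U} :=
    (((h.measurable_mode k).mono (ℱ.le k) le_rfl) (measurableSet_singleton true)).union
      (((h.measurable_iterate k).mono (ℱ.le k) le_rfl) hU.measurableSet).compl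
  simpa [Measure.real, Function.comp_def] using
    (ENNReal.tendsto_toReal (measure_ne_top μ ∅)).comp
      (tendsto_measure_of_ae_tendsto_indicator_of_isFiniteMeasure atTop .empty hmeas hlim)

theorem indepFun_matEntries_gradient (h : IsRSHTRRun f δ Δ μ ℱ P v t gm x)
    (hf : Continuous (∇ f)) (k : ℕ) :
    IndepFun (fun ω => matEntries (P k ω)) (fun ω => (∇ f (x k ω)).ofLp) μ :=
  indep_of_indep_of_le_right (h.indep_past k) <| Measurable.comap_le <|
    (WithLp.measurable_ofLp 2 _).comp (hf.measurable.comp (h.measurable_iterate k))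

theorem measure_not_isWellSketched_gradient_le (h : IsRSHTRRun f δ Δ μ ℱ P v t gm x)
    [IsProbabilityMeasure μ] [NeZero s] (hf : Continuous (∇ f)) (k : ℕ) :
    μ.real {ω | ¬ IsWellSketched (3 / 2 * ((n : ℝ) / s) + 1 / 5) (P k ω) (∇ f (x k ω)).ofLp}
      ≤ 2 * Real.exp (-(1 / 20) * s) := by
  have hP : Measurable fun ω => matEntries (P k ω) :=
    (h.measurable_mat k).mono (ℱ.le (k + 1)) le_rfl
  have hg : Measurable fun ω => (∇ f (x k ω)).ofLp :=
    (WithLp.measurable_ofLp 2 _).comp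
      (hf.measurable.comp ((h.measurable_iterate k).mono (ℱ.le k) le_rfl))
  have hcurry : Continuous fun z : (Fin s × Fin n → ℝ) × (Fin n → ℝ) =>
      ((Matrix.of fun i j => z.1 (i, j) : Matrix (Fin s) (Fin n) ℝ), z.2) :=
    (continuous_matrix fun i j => (continuous_apply (i, j)).comp continuous_fst).prodMk
      continuous_snd
  exact measure_le_of_indepFun hP.aemeasurable hg.aemeasurable
    (h.indepFun_matEntries_gradient hf k)
    ((isClosed_setOf_isWellSketched _).isOpen_compl.preimage hcurry).measurableSet
    (h.gaussian k).measure_not_isWellSketched_le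

end IsRSHTRRun

end Run

theorem one_sub_sub_le_measureReal {Ω : Type*} [MeasurableSpace Ω] {μ : Measure Ω}
    [IsProbabilityMeasure μ] {A B S : Set Ω} (h : ∀ ω, ω ∉ A → ω ∉ B → ω ∈ S) :
    1 - μ.real A - μ.real B ≤ μ.real S := by
  have hcover : Set.univ ⊆ S ∪ (A ∪ B) := fun ω _ => by
    by_contra hω
    simp only [Set.mem_union, not_or] at hω
    exact hω.1 (h ω hω.2.1 hω.2.2)
  have hsum := measureReal_mono (μ := μ) hcover
  rw [probReal_univ] at hsum
  linarith [measureReal_union_le (μ := μ) S (A ∪ B), measureReal_union_le (μ := μ) A B]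

theorem theorem3_general {n s : ℕ} (hn : 0 < n) (hs : 0 < s)
    {f : EuclideanSpace ℝ (Fin n) → ℝ} (hf : ContDiff ℝ 2 f) {δ Δ : ℝ} (hΔ : 0 < Δ)
    {Ω : Type*} [mΩ : MeasurableSpace Ω] {μ : Measure Ω} [IsProbabilityMeasure μ]
    {ℱ : Filtration ℕ mΩ} {P : ℕ → Ω → Matrix (Fin s) (Fin n) ℝ} {v : ℕ → Ω → Fin s → ℝ}
    {t : ℕ → Ω → ℝ} {gm : ℕ → Ω → Bool} {x : ℕ → Ω → EuclideanSpace ℝ (Fin n)}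
    (hrun : IsRSHTRRun f δ Δ μ ℱ P v t gm x) {xbar : EuclideanSpace ℝ (Fin n)}
    (hgrad : ∇ f xbar = 0) (hpd : (hessMat f xbar).PosDef)
    (hconv : ∀ᵐ ω ∂μ, Tendsto (fun k => x k ω) atTop (𝓝 xbar)) {η : ℝ} (hη : 0 < η) :
    ∀ᶠ k in atTop, 1 - 2 * Real.exp (-(1 / 20) * s) - η ≤
      μ.real {ω | matNorm (hessMat f xbar) (x (k + 1) ω - xbar) ≤
        √(1 - 1 / (4 * condNumber (hessMat f xbar) * (√((n : ℝ) / s) + 1) ^ 2)) *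
          matNorm (hessMat f xbar) (x k ω - xbar)} := by
  have : NeZero n := .of_pos hn
  have : NeZero s := .of_pos hs
  have hτ : 1 + 2 * (3 / 2 * ((n : ℝ) / s) + 1 / 5) < 4 * (√((n : ℝ) / s) + 1) ^ 2 := by
    nlinarith [Real.sq_sqrt (show (0 : ℝ) ≤ (n : ℝ) / s by positivity),
      Real.sqrt_nonneg ((n : ℝ) / s)]
  obtain ⟨U, hstep, hU, hxU⟩ := eventually_nhds_iff.1 <|
    eventually_matNorm_add_rshtrDir_le (s := s) hf hgrad hpd (by positivity) hτ
  filter_upwards [(hrun.tendsto_measure_not_local hΔ hconv hU hxU).eventually_le_const hη]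
    with k hk
  have hsketch := hrun.measure_not_isWellSketched_gradient_le
    (contDiff_gradient hf (m := 1) (by norm_num)).continuous k
  refine (sub_le_sub (sub_le_sub_left hsketch 1) hk).trans
    (one_sub_sub_le_measureReal fun ω hP hlocal => ?_)
  obtain ⟨hmode, hxk⟩ := not_or.1 hlocal
  rw [Bool.not_eq_true] at hmode
  rw [Set.mem_ofPred_eq, hrun.step_of_mode_eq_false hmode, mul_comm 4, mul_assoc]
  exact hstep (x k ω) (not_not.1 hxk) _ _ _ (hrun.subproblem_of_mode_eq_false hmode)
    (not_not.1 hP)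

theorem theorem3 :
    ∃ C 𝒞 : ℝ, 0 < C ∧ 0 < 𝒞 ∧
      ∀ (n s : ℕ), 1 ≤ s → s ≤ n →
      ∀ (f : EuclideanSpace ℝ (Fin n) → ℝ) (L M : ℝ), HasLipschitzGradHess f L M →
      ∀ (δ Δ : ℝ), 0 ≤ δ → 0 < Δ →
      ∀ (Ω : Type*) [mΩ : MeasurableSpace Ω] (μ : Measure Ω) [IsProbabilityMeasure μ]
        (ℱ : Filtration ℕ mΩ) (P : ℕ → Ω → Matrix (Fin s) (Fin n) ℝ)
        (v : ℕ → Ω → Fin s → ℝ) (t : ℕ → Ω → ℝ) (gm : ℕ → Ω → Bool)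
        (x : ℕ → Ω → EuclideanSpace ℝ (Fin n)),
      IsRSHTRRun f δ Δ μ ℱ P v t gm x →
      ∀ xbar : EuclideanSpace ℝ (Fin n),
      ∇ f xbar = 0 → (hessMat f xbar).PosDef →
      (∀ᵐ ω ∂μ, Tendsto (fun k => x k ω) atTop (𝓝 xbar)) →
      ∃ k₀ : ℕ, ∀ k ≥ k₀,
        μ.real {ω | matNorm (hessMat f xbar) (x (k + 1) ω - xbar) ≤
            √(1 - 1 / (4 * condNumber (hessMat f xbar) * (√((n : ℝ) / s) + 𝒞) ^ 2)) *
              matNorm (hessMat f xbar) (x k ω - xbar)}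
          ≥ 1 - 2 * Real.exp (-(C / 4) * s) - 8 * Real.exp (-(s : ℝ)) := by
  refine ⟨1 / 5, 1, by norm_num, one_pos, fun n s hs hsn f _ _ hf _ _ _ hΔ _ _ _ _ _ _ _ _ _ _
    hrun _ hgrad hpd hconv => eventually_atTop.1 ?_⟩
  rw [show -(1 / 5 / 4 : ℝ) = -(1 / 20) by norm_num]
  exact theorem3_general (hs.trans hsn) hs hf.contDiff hΔ hrun hgrad hpd hconv (by positivity)
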